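/- Let $p$ be an odd prime, $\mathbf{F}$ a field of characteristic $p$, and $L=\bigoplus_{i\ge 1}L_i$ an infinite-dimensional graded Lie algebra of maximal class over $\mathbf{F}$; that is, $\dim L_1=2$, $\dim L_i\le 1$ for $i\ge 2$, and $L$ is generated by $L_1$. For $i\ge 2$ let $C_i=C_{L_1}(L_i)$ be its two-step centralizers. If some $C_n$ differs from $C_2$, let $n$ be the least such index. The first constituent of $L$ is the sequence $C_2,\dots,C_n$, to which one assigns the length $n=2q$ (here $q$, which is a power of $p$, is the parameter of $L$). The further constituents are the sequences $C_{i+1},\dots,C_{i+m}$ with $C_i\ne C_2$, $C_{i+m}\ne C_2$ and $C_{i+1}=\dots=C_{i+m-1}=C_2$, where $i\ge 2$ and $m\ge 1$; such a constituent has length $m$. A constituent is called long if its length is $2q$ and short if its length is $q$. The deflation $L^{\downarrow}$ of $L$ is the Lie algebra $\bigoplus_{i\ge 1}L_{pi}$ extended by the derivation $(\operatorname{ad}x)^p$, for some $x\in L_1\setminus C_2$; it is graded by giving weight $i$ to $L_{pi}$ and weight $1$ to $(\operatorname{ad}x)^p$. For a Lie algebra $N=\bigoplus_{i\ge 1}N_i$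 with $\dim N_1=2$ and a one-dimensional subspace $M$ of $N_1$, the inflation ${}^{M}N$ is the Lie algebra $\bigl(M\oplus\bigoplus_{i\ge 2}N_i\bigr)\otimes\mathbf{F}[\varepsilon]/(\varepsilon^p)$ extended by the derivation $1\otimes\frac{d}{d\varepsilon}+\operatorname{ad}s\otimes\varepsilon^{p-1}$, for some $s\in N_1\setminus M$; it is graded by giving weight $pj-i$ to $u\otimes\varepsilon^i$, for $u$ of weight $j$ and $0\le i<p$, and weight $1$ to the derivation. The algebra $L$ is called inflated if, as a graded Lie algebra, $L\cong{}^{M}(L^{\downarrow})$ for some one-dimensional subspace $M$ of $(L^{\downarrow})_1$. Suppose that $L$ has exactly two distinct two-step centralizers, and that among its constituents, taken in order of occurrence, there is a second non-short one and it is long. Then every constituent of $L$ is short or long, and $L$ is inflated. -/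

import Mathlib

open scoped TensorProduct Polynomial

noncomputable section

namespace MaximalClass

attribute [local instance 100] LieRing.ofAssociativeRing

/-! ### Graded Lie algebras of maximal class, two-step centralizers, constituents -/

section Basic

variable {F L : Type*} [Field F] [LieRing L] [LieAlgebra F L]

/-- A graded Lie algebra `L = ⨁_{i ≥ 1} 𝒢 i` is of maximal class if `dim (𝒢 1) = 2`,
`dim (𝒢 i) ≤ 1` for `i ≥ 2`, and `L` is generated by `𝒢 1`. -/
structure IsMaximalClass (𝒢 : ℕ → Submodule F L) [GradedLieAlgebra 𝒢] : Prop where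
  zero_eq_bot : 𝒢 0 = ⊥
  rank_one : Module.rank F (𝒢 1) = 2
  rank_le_one : ∀ i, 2 ≤ i → Module.rank F (𝒢 i) ≤ 1
  generated : LieSubalgebra.lieSpan F L (𝒢 1 : Set L) = ⊤

/-- The two-step centralizer `C_i`, the centralizer in `𝒢 1` of `𝒢 i`; meant for `i ≥ 2`. -/
def twoStep (𝒢 : ℕ → Submodule F L) (i : ℕ) : Submodule F L where
  carrier := {u | u ∈ 𝒢 1 ∧ ∀ v ∈ 𝒢 i, ⁅u, v⁆ = 0}
  add_mem' := fun ha hb =>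
    ⟨add_mem ha.1 hb.1, fun v hv => by rw [add_lie, ha.2 v hv, hb.2 v hv, add_zero]⟩
  zero_mem' := ⟨zero_mem _, fun v _ => zero_lie v⟩
  smul_mem' := fun c _ ha =>
    ⟨Submodule.smul_mem _ c ha.1, fun v hv => by rw [smul_lie, ha.2 v hv, smul_zero]⟩

/-- The set of all two-step centralizers `C_i`, `i ≥ 2`. -/
def twoStepSet (𝒢 : ℕ → Submodule F L) : Set (Submodule F L) :=
  twoStep 𝒢 '' Set.Ici 2

/-- `IsConstituent 𝒢 i m`: there is a constituent of length `m` which ends with `C_{i+m}` and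
which, unless it is the first one, starts with `C_{i+1}`. The first constituent
`C_2, …, C_m` is given the position `i = 0` and, by convention, the length `m`. -/
inductive IsConstituent (𝒢 : ℕ → Submodule F L) : ℕ → ℕ → Prop
  | first (m : ℕ) (hm : 2 ≤ m) (hlast : twoStep 𝒢 m ≠ twoStep 𝒢 2)
      (hinner : ∀ j, 2 ≤ j → j < m → twoStep 𝒢 j = twoStep 𝒢 2) : IsConstituent 𝒢 0 m
  | later (i m : ℕ) (hi : 2 ≤ i) (hm : 1 ≤ m) (hprev : twoStep 𝒢 i ≠ twoStep 𝒢 2)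
      (hlast : twoStep 𝒢 (i + m) ≠ twoStep 𝒢 2)
      (hinner : ∀ j, i < j → j < i + m → twoStep 𝒢 j = twoStep 𝒢 2) : IsConstituent 𝒢 i m

/-- The weight in which the second two-step centralizer first occurs, that is, the length of the
first constituent. -/
def firstLength (𝒢 : ℕ → Submodule F L) : ℕ :=
  sInf {n | 2 ≤ n ∧ twoStep 𝒢 n ≠ twoStep 𝒢 2}

/-- A length `m` is long if it equals `2 q`, where `2 q` is the length of the first
constituent. -/
def IsLong (𝒢 : ℕ → Submodule F L) (m : ℕ) : Prop :=
  m = firstLength 𝒢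

/-- A length `m` is short if it equals `q`, where `2 q` is the length of the first
constituent. -/
def IsShort (𝒢 : ℕ → Submodule F L) (m : ℕ) : Prop :=
  2 * m = firstLength 𝒢

/-- The constituent at position `i`, of length `m`, is the second non-short one: it is not short,
and exactly one earlier constituent is not short. -/
def IsSecondNonShort (𝒢 : ℕ → Submodule F L) (i m : ℕ) : Prop :=
  IsConstituent 𝒢 i m ∧ ¬ IsShort 𝒢 m ∧
    {j : ℕ | j < i ∧ ∃ l, IsConstituent 𝒢 j l ∧ ¬ IsShort 𝒢 l}.ncard = 1

end Basic

/-! ### Extending a Lie algebra by a derivation -/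

section Extension

variable {F K : Type*} [Field F] [LieRing K] [LieAlgebra F K]

/-- The homomorphism from the one-dimensional Lie algebra `F` that sends `a` to `a D`. -/
def derHom (D : LieDerivation F K K) : F →ₗ⁅F⁆ LieDerivation F K K where
  toFun a := a • D
  map_add' a b := add_smul a b D
  map_smul' a b := mul_smul a b D
  map_lie' := by
    intro a b
    ext v
    simp [LieRing.of_associative_ring_bracket, mul_comm]

/-- The Lie algebra `K ⋊ F s`, in which `s = ⟨0, 1⟩` acts on `K` as the derivation `D`. -/
abbrev DerExt (D : LieDerivation F K K) : Type _ :=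
  LieAlgebra.SemiDirectSum K F (derHom D)

end Extension

/-! ### Deflation -/

section Deflation

variable {F L : Type*} [Field F] [LieRing L] [LieAlgebra F L]

/-- In characteristic `p`, the `p`-th power of the inner derivation `ad x` is a derivation. -/
def adPow (F : Type*) {L : Type*} [Field F] [LieRing L] [LieAlgebra F L]
    (p : ℕ) [Fact p.Prime] [CharP F p] (x : L) : LieDerivation F L L where
  toLinearMap := (LieAlgebra.ad F L x) ^ p
  leibniz' a b := by
    have hp : p.Prime := Fact.out
    have hD : ∀ v : L, (LieAlgebra.ad F L x ^ p) v = (LieDerivation.ad F L x)^[p] v := by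
      intro v
      rw [Module.End.pow_apply, ← LieDerivation.coe_ad_apply_eq_ad_apply]
      rfl
    have hmid : ∀ i ∈ Finset.range p, i ∉ ({0} : Finset ℕ) →
        p.choose i • ⁅(LieDerivation.ad F L x)^[i] a, (LieDerivation.ad F L x)^[p - i] b⁆ = 0 := by
      intro i hi hi0
      have hdvd : p ∣ p.choose i := hp.dvd_choose_self (by simpa using hi0) (by simpa using hi)
      rw [← Nat.cast_smul_eq_nsmul F, (CharP.cast_eq_zero_iff F p _).2 hdvd, zero_smul]
    rw [hD, hD, hD, LieDerivation.iterate_apply_lie', Finset.sum_range_succ,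
      ← Finset.sum_subset (by simpa using hp.pos) hmid]
    simp only [Finset.sum_singleton, Nat.choose_zero_right, Nat.choose_self, one_smul, Nat.sub_zero,
      Nat.sub_self, Function.iterate_zero, id_eq]
    rw [← lie_skew b, sub_neg_eq_add, add_comm]

/-- The subalgebra `⨁_i 𝒢 (p i)`. -/
def multiples (p : ℕ) (𝒢 : ℕ → Submodule F L) [SetLike.GradedBracket 𝒢] : LieSubalgebra F L where
  toSubmodule := ⨆ i, 𝒢 (p * i)
  lie_mem' := by
    intro u v hu hv
    change u ∈ ⨆ i, 𝒢 (p * i) at hu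
    change v ∈ ⨆ i, 𝒢 (p * i) at hv
    change ⁅u, v⁆ ∈ ⨆ i, 𝒢 (p * i)
    induction hu using Submodule.iSup_induction' with
    | zero => simp
    | add a b _ _ ha hb => rw [add_lie]; exact add_mem ha hb
    | mem i a ha =>
      induction hv using Submodule.iSup_induction' with
      | zero => simp
      | add c d _ _ hc hd => rw [lie_add]; exact add_mem hc hd
      | mem j c hc =>
        refine Submodule.mem_iSup_of_mem (i + j) ?_
        rw [mul_add]
        exact SetLike.GradedBracket.bracket_mem ha hc

variable (p : ℕ) [Fact p.Prime] [CharP F p] (𝒢 : ℕ → Submodule F L) [SetLike.GradedBracket 𝒢]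

theorem adPow_mem (x : L) (hx : x ∈ 𝒢 1) (n : ℕ) (v : L) (hv : v ∈ 𝒢 n) :
    adPow F p x v ∈ 𝒢 (n + p) := by
  have key : ∀ k : ℕ, ((LieAlgebra.ad F L x) ^ k) v ∈ 𝒢 (n + k) := by
    intro k
    induction k with
    | zero => simpa using hv
    | succ k ih =>
      rw [pow_succ', Module.End.mul_apply, LieAlgebra.ad_apply]
      have := SetLike.GradedBracket.bracket_mem (ℒ := 𝒢) hx ih
      rwa [show n + (k + 1) = 1 + (n + k) by ring]
  exact key p

theorem adPow_mem_multiples (x : L) (hx : x ∈ 𝒢 1) (v : L) (hv : v ∈ multiples p 𝒢) :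
    adPow F p x v ∈ multiples p 𝒢 := by
  change v ∈ ⨆ i, 𝒢 (p * i) at hv
  change _ ∈ ⨆ i, 𝒢 (p * i)
  induction hv using Submodule.iSup_induction' with
  | zero => simp
  | add a b _ _ ha hb => rw [map_add]; exact add_mem ha hb
  | mem i a ha => exact Submodule.mem_iSup_of_mem (i + 1) (adPow_mem p 𝒢 x hx _ a ha)

/-- The derivation `(ad x)^p` of `⨁_i 𝒢 (p i)`, for `x` of weight `1`. -/
def deflationDer (x : L) (hx : x ∈ 𝒢 1) :
    LieDerivation F (multiples p 𝒢) (multiples p 𝒢) where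
  toLinearMap := (adPow F p x).toLinearMap.restrict
    (p := (multiples p 𝒢).toSubmodule) (q := (multiples p 𝒢).toSubmodule) (adPow_mem_multiples p 𝒢 x hx)
  leibniz' a b := Subtype.ext ((adPow F p x).apply_lie_eq_sub (a : L) (b : L))

/-- The deflation of the algebra of maximal class with grading `𝒢`: the Lie algebra
`⨁_i 𝒢 (p i)`, extended by the derivation `(ad x)^p`. Here `x ∈ 𝒢 1` is to be taken outside
`C_2`; the choice does not matter up to graded isomorphism. -/
abbrev Deflation (x : L) (hx : x ∈ 𝒢 1) : Type _ :=
  DerExt (deflationDer p 𝒢 x hx)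

/-- The grading of the deflation: `𝒢 (p n)` has weight `n`, and the derivation `(ad x)^p` has
weight `1`. -/
def deflationGrading (x : L) (hx : x ∈ 𝒢 1) (n : ℕ) : Submodule F (Deflation p 𝒢 x hx) where
  carrier := {z | (z.left : L) ∈ 𝒢 (p * n) ∧ (n ≠ 1 → z.right = 0)}
  add_mem' := fun ha hb =>
    ⟨add_mem ha.1 hb.1, fun h => by
      rw [LieAlgebra.SemiDirectSum.add_eq_mk, ha.2 h, hb.2 h, add_zero]⟩
  zero_mem' := ⟨zero_mem _, fun _ => rfl⟩
  smul_mem' := fun c _ ha =>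
    ⟨Submodule.smul_mem _ c ha.1, fun h => by
      rw [LieAlgebra.SemiDirectSum.smul_eq_mk, ha.2 h, smul_zero]⟩

instance deflationGrading_gradedBracket (x : L) (hx : x ∈ 𝒢 1) :
    SetLike.GradedBracket (deflationGrading p 𝒢 x hx) where
  bracket_mem := by
    intro i j z w hz hw
    have hzw : ∀ {i j : ℕ} {z w : Deflation p 𝒢 x hx}, z ∈ deflationGrading p 𝒢 x hx i →
        w ∈ deflationGrading p 𝒢 x hx j →
        z.right • adPow F p x (w.left : L) ∈ 𝒢 (p * (i + j)) := by
      intro i j z w hz hw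
      by_cases hi : i = 1
      · refine Submodule.smul_mem _ _ ?_
        rw [hi, show p * (1 + j) = p * j + p by ring]
        exact adPow_mem p 𝒢 x hx _ _ hw.1
      · rw [hz.2 hi, zero_smul]
        exact zero_mem _
    refine ⟨?_, fun _ => ?_⟩
    · refine sub_mem (add_mem ?_ (hzw hz hw)) ?_
      · rw [mul_add]
        exact SetLike.GradedBracket.bracket_mem hz.1 hw.1
      · rw [add_comm i j]
        exact hzw hw hz
    · rw [LieAlgebra.SemiDirectSum.lie_eq_mk]
      simp [LieRing.of_associative_ring_bracket, mul_comm]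

theorem deflationGrading_zero (h0 : 𝒢 0 = ⊥) (x : L) (hx : x ∈ 𝒢 1) :
    deflationGrading p 𝒢 x hx 0 = ⊥ := by
  refine eq_bot_iff.2 fun z hz => ?_
  have h1 : (z.left : L) ∈ 𝒢 (p * 0) := hz.1
  rw [mul_zero, h0, Submodule.mem_bot] at h1
  exact (Submodule.mem_bot F).2
    (LieAlgebra.SemiDirectSum.ext (Subtype.ext h1) (hz.2 zero_ne_one))

theorem iSup_deflationGrading (x : L) (hx : x ∈ 𝒢 1) :
    ⨆ n, deflationGrading p 𝒢 x hx n = ⊤ := by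
  have hl : ∀ (v : L) (hv : v ∈ ⨆ i, 𝒢 (p * i)),
      (⟨⟨v, hv⟩, 0⟩ : Deflation p 𝒢 x hx) ∈ ⨆ n, deflationGrading p 𝒢 x hx n := by
    intro v hv
    induction hv using Submodule.iSup_induction' with
    | zero => exact zero_mem _
    | mem i a ha => exact Submodule.mem_iSup_of_mem i ⟨ha, fun _ => rfl⟩
    | add a b ha' hb' ha hb =>
      have := add_mem ha hb
      rw [LieAlgebra.SemiDirectSum.add_eq_mk, add_zero] at this
      exact this
  refine eq_top_iff.2 fun z _ => ?_
  have h1 := hl z.left z.left.2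
  have h2 : (⟨0, z.right⟩ : Deflation p 𝒢 x hx) ∈ ⨆ n, deflationGrading p 𝒢 x hx n :=
    Submodule.mem_iSup_of_mem 1 ⟨zero_mem _, fun h => absurd rfl h⟩
  have h3 := add_mem h1 h2
  rw [LieAlgebra.SemiDirectSum.add_eq_mk] at h3
  simpa using h3

end Deflation

/-! ### Inflation -/

section Inflation

variable {F : Type*} [Field F]

/-- The truncated polynomial algebra `F[ε]/(ε^p)`. -/
abbrev Trunc (F : Type*) [Field F] (p : ℕ) : Type _ :=
  AdjoinRoot (Polynomial.X ^ p : F[X])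

/-- The class `ε` of the indeterminate. -/
def eps (F : Type*) [Field F] (p : ℕ) : Trunc F p :=
  AdjoinRoot.root _

/-- The derivation `d/dε` of `F[ε]/(ε^p)`, in characteristic `p`. -/
def truncDer (F : Type*) [Field F] (p : ℕ) [CharP F p] :
    Derivation F (Trunc F p) (Trunc F p) :=
  Derivation.liftOfSurjective (f := AdjoinRoot.mkₐ (Polynomial.X ^ p : F[X]))
    (d := Polynomial.derivative') AdjoinRoot.mk_surjective (by
      intro f hf
      obtain ⟨g, rfl⟩ := AdjoinRoot.mk_eq_zero.1 hf
      refine AdjoinRoot.mk_eq_zero.2 ⟨Polynomial.derivative g, ?_⟩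
      simp)

variable {N : Type*} [LieRing N] [LieAlgebra F N]

/-- The derivation of an ideal `I` induced by `ad s`. -/
def idealDer (I : LieIdeal F N) (s : N) : LieDerivation F I I where
  toLinearMap := LieModule.toEnd F N I s
  leibniz' a b := by
    refine Subtype.ext ?_
    change ⁅s, ⁅(a : N), (b : N)⁆⁆ = ⁅(a : N), ⁅s, (b : N)⁆⁆ - ⁅(b : N), ⁅s, (a : N)⁆⁆
    rw [leibniz_lie s, ← lie_skew (b : N) ⁅s, (a : N)⁆]
    abel

/-- The derivation `d/dε ⊗ 1 + ε^(p-1) ⊗ ad s` of `F[ε]/(ε^p) ⊗ I`. -/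
def inflationDer (p : ℕ) [CharP F p] (I : LieIdeal F N) (s : N) :
    LieDerivation F (Trunc F p ⊗[F] I) (Trunc F p ⊗[F] I) :=
  Lie.Derivation.ofDerivation I (truncDer F p) +
    (eps F p ^ (p - 1)) • Lie.Derivation.ofLieDerivation (Trunc F p) (idealDer I s)

/-- The ideal `M ⊕ ⨁_{i ≥ 2} ℋ i` of `N = ⨁_{i ≥ 1} ℋ i`, for a subspace `M` of `ℋ 1`. -/
def idealOf (ℋ : ℕ → Submodule F N) [SetLike.GradedBracket ℋ] (h0 : ℋ 0 = ⊥)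
    (hsup : ⨆ i, ℋ i = ⊤) (M : Submodule F N) : LieIdeal F N where
  toSubmodule := M ⊔ ⨆ i, ℋ (i + 2)
  lie_mem := by
    intro u v hv0
    clear hv0
    have hu : u ∈ ⨆ i, ℋ i := hsup ▸ Submodule.mem_top
    have hv : v ∈ ⨆ i, ℋ i := hsup ▸ Submodule.mem_top
    refine Submodule.mem_sup_right ?_
    induction hu using Submodule.iSup_induction' with
    | zero => simp
    | add a b _ _ ha hb => rw [add_lie]; exact add_mem ha hb
    | mem i a ha =>
      induction hv using Submodule.iSup_induction' with
      | zero => simp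
      | add c d _ _ hc hd => rw [lie_add]; exact add_mem hc hd
      | mem j c hc =>
        rcases Nat.eq_zero_or_pos i with rfl | hi
        · rw [h0, Submodule.mem_bot] at ha
          simp [ha]
        rcases Nat.eq_zero_or_pos j with rfl | hj
        · rw [h0, Submodule.mem_bot] at hc
          simp [hc]
        refine Submodule.mem_iSup_of_mem (i + j - 2) ?_
        rw [show i + j - 2 + 2 = i + j by omega]
        exact SetLike.GradedBracket.bracket_mem ha hc

/-- The inflation of `N` with respect to the ideal `I` of codimension one: the Lie algebra
`F[ε]/(ε^p) ⊗ I`, extended by the derivation `d/dε ⊗ 1 + ε^(p-1) ⊗ ad s`. Here `s` is to be taken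
of weight `1` and outside `I`; the choice does not matter up to graded isomorphism. -/
abbrev Inflation (p : ℕ) [CharP F p] (I : LieIdeal F N) (s : N) : Type _ :=
  DerExt (inflationDer p I s)

/-- The grading of the inflation: for `0 ≤ i < p`, the elements of `ε^i ⊗ (I ∩ ℋ j)` have weight
`p j - i`, and the derivation which extends `F[ε]/(ε^p) ⊗ I` has weight `1`. -/
def inflationGrading (p : ℕ) [CharP F p] (ℋ : ℕ → Submodule F N) (I : LieIdeal F N) (s : N)
    (n : ℕ) : Submodule F (Inflation p I s) where
  carrier := {z |
    z.left ∈ (⨆ (j : ℕ) (i : ℕ) (_ : i < p ∧ n + i = p * j),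
      ((ℋ j).comap I.toSubmodule.subtype).map
        (TensorProduct.mk F (Trunc F p) I (eps F p ^ i))) ∧
    (n ≠ 1 → z.right = 0)}
  add_mem' := fun ha hb =>
    ⟨add_mem ha.1 hb.1, fun h => by
      rw [LieAlgebra.SemiDirectSum.add_eq_mk, ha.2 h, hb.2 h, add_zero]⟩
  zero_mem' := ⟨zero_mem _, fun _ => rfl⟩
  smul_mem' := fun c _ ha =>
    ⟨Submodule.smul_mem _ c ha.1, fun h => by
      rw [LieAlgebra.SemiDirectSum.smul_eq_mk, ha.2 h, smul_zero]⟩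

end Inflation

/-! ### Inflated algebras -/

section Inflated

variable {F L : Type*} [Field F] [LieRing L] [LieAlgebra F L]

/-- `L` is inflated: it is isomorphic, as a graded Lie algebra, to the inflation of its deflation
`L↓` with respect to some one-dimensional subspace `M` of the component of weight `1` of `L↓`. -/
def IsInflated (p : ℕ) [Fact p.Prime] [CharP F p] (𝒢 : ℕ → Submodule F L) [GradedLieAlgebra 𝒢]
    (h : IsMaximalClass 𝒢) : Prop :=
  ∃ (x : L) (hx : x ∈ 𝒢 1), x ∉ twoStep 𝒢 2 ∧
  ∃ M : Submodule F (Deflation p 𝒢 x hx),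
    M ≤ deflationGrading p 𝒢 x hx 1 ∧ Module.finrank F M = 1 ∧
  ∃ s ∈ deflationGrading p 𝒢 x hx 1, s ∉ M ∧
  ∃ e : L ≃ₗ⁅F⁆ Inflation p
      (idealOf (deflationGrading p 𝒢 x hx) (deflationGrading_zero p 𝒢 h.zero_eq_bot x hx)
        (iSup_deflationGrading p 𝒢 x hx) M) s,
    ∀ n v, v ∈ 𝒢 n ↔ e v ∈ inflationGrading p (deflationGrading p 𝒢 x hx) _ s n

end Inflated

end MaximalClass

end

/-!
Let `y` span the first two-step centralizer and `x` the other one, and put `v_1 = y` and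
`v_{i+1} = [v_i, x + y]`. The Jacobi identity with `x + y` says that the structure constants in
`[v_i, v_j] = ν i j • v_{i+j}` form a difference table, so that in characteristic `p` a block of
`p^t` steps is again a single difference step; the Jacobi identity with `y` makes many of them
vanish. Divisibility of binomial coefficients then shows that the first constituent has length
`2q` with `q = p^t`, and every other one length `2q` or `2q - p^s` with `s ≤ t`. When the second
non-short constituent is long, a first constituent of length strictly between `q` and `2q` would
end one of the patterns `2q, q^k, m`, while the algebra begins with `2q, q^r, 2q`; evaluating a few
structure constants in two ways gives `r ≤ k ≤ r + 1` and excludes both remaining cases.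

Hence the weights in which `x` centralizes are multiples of `p`, and the difference rule determines
all structure constants from those at multiples of `p`: for `i, j < p`,
`ν (p a - i) (p b - j)` is `(i + j).choose i * ν (p a) (p b)` if `i + j < p` and `0` otherwise.
These binomial coefficients are the structure constants of the divided powers `(-ε)^i / i!` in
`F[ε]/(ε^p)`, so `v_{p a - i} ↦ (-ε)^i / i! ⊗ v_{p a}` is an isomorphism with the inflation of the
deflation.
-/

noncomputable section

namespace MaximalClass

attribute [local instance 100] LieRing.ofAssociativeRing

/-! ### Binomial coefficients modulo `p` -/

section Binomial

variable {p : ℕ} [Fact p.Prime]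

theorem choose_prime_pow_modEq (n s : ℕ) : n.choose (p ^ s) ≡ n / p ^ s [MOD p] := by
  have hp : p.Prime := Fact.out
  have lucas := Choose.choose_modEq_choose_mul_prod_range_choose (p := p) (n := n) (k := p ^ s) s
  have digits : ∏ i ∈ Finset.range s, (n / p ^ i % p).choose (p ^ s / p ^ i % p) = 1 := by
    refine Finset.prod_eq_one fun i hi => ?_
    have hi : i < s := Finset.mem_range.1 hi
    have : p ^ s / p ^ i % p = 0 := by
      rw [Nat.pow_div hi.le hp.pos]
      exact Nat.mod_eq_zero_of_dvd (dvd_pow_self p (by omega))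
    rw [this, Nat.choose_zero_right]
  rw [digits, Nat.div_self (pow_pos hp.pos s), Nat.choose_one_right, Nat.cast_one, mul_one] at lucas
  exact Int.natCast_modEq_iff.1 lucas

theorem exists_pow_dvd_of_forall_dvd_choose {n R : ℕ} (hn : n ≠ 0)
    (h : ∀ b, 1 ≤ b → b < R → p ∣ n.choose b) : ∃ s, p ^ s ∣ n ∧ R ≤ p ^ s := by
  have hp : p.Prime := Fact.out
  obtain ⟨s, k, hk, rfl⟩ := Nat.exists_eq_pow_mul_and_not_dvd hn p hp.ne_one
  have hq : 0 < p ^ s := pow_pos hp.pos s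
  refine ⟨s, Dvd.intro _ rfl, ?_⟩
  by_contra! hR
  have := choose_prime_pow_modEq (p := p) (p ^ s * k) s
  rw [Nat.mul_div_cancel_left _ hq] at this
  exact hk ((this.dvd_iff dvd_rfl).1 (h _ hq hR))

theorem exists_pow_dvd_of_forall_dvd_choose_add {m R : ℕ} (hm : m ≠ 0)
    (h : ∀ a, 1 ≤ a → a < R → p ∣ (m - 1 + a).choose a) : ∃ s, p ^ s ∣ m ∧ R ≤ p ^ s := by
  have hp : p.Prime := Fact.out
  obtain ⟨s, k, hk, rfl⟩ := Nat.exists_eq_pow_mul_and_not_dvd hm p hp.ne_one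
  have hq : 0 < p ^ s := pow_pos hp.pos s
  refine ⟨s, Dvd.intro _ rfl, ?_⟩
  by_contra! hR
  have := choose_prime_pow_modEq (p := p) (p ^ s * k - 1 + p ^ s) s
  rw [show p ^ s * k - 1 + p ^ s = (p ^ s - 1) + p ^ s * k by omega,
    Nat.add_mul_div_left _ _ hq, Nat.div_eq_of_lt (by omega), zero_add,
    show p ^ s - 1 + p ^ s * k = p ^ s * k - 1 + p ^ s by omega] at this
  exact hk ((this.dvd_iff dvd_rfl).1 (h _ hq hR))

theorem neg_one_pow_mul_choose_prime_pow_sub_one {R : Type*} [CommRing R] [CharP R p] {t j : ℕ}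
    (hj : j < p ^ t) : (-1 : R) ^ j * ((p ^ t - 1).choose j : R) = 1 := by
  have hp : p.Prime := Fact.out
  induction j with
  | zero => simp
  | succ j ih =>
    have vanish : ((p ^ t).choose (j + 1) : R) = 0 :=
      (CharP.cast_eq_zero_iff R p _).2 (hp.dvd_choose_pow (by omega) (by omega))
    rw [show p ^ t = p ^ t - 1 + 1 by omega, Nat.choose_succ_succ, Nat.cast_add] at vanish
    linear_combination (-1 : R) ^ (j + 1) * vanish + ih (by omega)

theorem dvd_choose_succ_of_modEq {k l : ℕ} (h : l ≡ k [MOD p]) (hl : ¬p ∣ l + 1) :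
    p ∣ k.choose (l + 1) := by
  have hp : p.Prime := Fact.out
  rcases le_total l k with hlk | hkl
  · have : p ∣ k.choose (l + 1) * (l + 1) := by
      rw [Nat.choose_succ_right_eq]
      exact ((Nat.modEq_iff_dvd' hlk).1 h).mul_left _
    exact (hp.dvd_mul.1 this).resolve_right hl
  · rw [Nat.choose_eq_zero_of_lt (Nat.lt_succ_of_le hkl)]
    exact dvd_zero p

omit [Fact p.Prime] in
theorem le_of_pow_lt_two_mul_pow {s t : ℕ} (hp : 2 ≤ p) (h : p ^ s < 2 * p ^ t) : s ≤ t := by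
  have : p ^ s < p ^ (t + 1) := h.trans_le (pow_succ' p t ▸ Nat.mul_le_mul_right _ hp)
  exact Nat.lt_succ_iff.1 ((Nat.pow_lt_pow_iff_right hp).1 this)

end Binomial

/-! ### Consecutive elements of a set of natural numbers -/

section Gaps

variable {S : Set ℕ} {u v m n q a b d : ℕ}

/-- `u` and `u + m` are consecutive elements of `S`. For the set `S` of the weights whose two-step
centralizer is not the first one, this is a constituent of length `m` which starts after `u`. -/
structure Gap (S : Set ℕ) (u m : ℕ) : Prop where
  start : u ∈ S
  pos : 0 < m
  last : u + m ∈ S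
  inner : ∀ j, u < j → j < u + m → j ∉ S

theorem Gap.le_of_lt (hg : Gap S u m) (hv : v ∈ S) (huv : u < v) : u + m ≤ v :=
  not_lt.1 fun h => hg.inner v huv h hv

theorem Gap.unique (hg : Gap S u m) (hg' : Gap S u n) : m = n := by
  have h := hg.le_of_lt hg'.last (Nat.lt_add_of_pos_right hg'.pos)
  have h' := hg'.le_of_lt hg.last (Nat.lt_add_of_pos_right hg.pos)
  omega

theorem exists_gap_before (ha : a ∈ S) (hu : u ∈ S) (hau : a < u) :
    ∃ w m, a ≤ w ∧ w + m = u ∧ Gap S w m := by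
  classical
  set w := Nat.findGreatest (· ∈ S) (u - 1)
  have hw : w ∈ S := Nat.findGreatest_spec (P := (· ∈ S)) (by omega : a ≤ u - 1) ha
  have hwu : w ≤ u - 1 := Nat.findGreatest_le (u - 1)
  refine ⟨w, u - w, Nat.le_findGreatest (by omega) ha, by omega, hw, by omega, ?_, ?_⟩
  · rwa [Nat.add_sub_cancel' (by omega)]
  · exact fun j hwj hju => Nat.findGreatest_is_greatest hwj (by omega)

theorem dvd_of_forall_gap_dvd (hn : IsLeast S n) (hdn : d ∣ n) (h : ∀ u m, Gap S u m → d ∣ m) :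
    ∀ u ∈ S, d ∣ u := by
  intro u
  induction u using Nat.strong_induction_on with
  | _ u ih =>
    intro hu
    rcases (hn.2 hu).eq_or_lt with rfl | hlt
    · exact hdn
    · obtain ⟨w, m, -, rfl, hg⟩ := exists_gap_before hn.1 hu hlt
      exact (ih w (Nat.lt_add_of_pos_right hg.pos) hg.start).add (h w m hg)

/-- `a`, `a + q`, …, `a + k q` are consecutive elements of `S`, if `k > 0`. -/
def GapRun (S : Set ℕ) (q a k : ℕ) : Prop :=
  ∀ l < k, Gap S (a + l * q) q

theorem GapRun.mem {k l : ℕ} (h : GapRun S q a k) (hk : a + k * q ∈ S) (hl : l ≤ k) :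
    a + l * q ∈ S :=
  hl.eq_or_lt.elim (fun e => e ▸ hk) fun hlt => (h l hlt).start

theorem exists_gapRun (ha : a ∈ S) (hb : b ∈ S) (hab : a ≤ b)
    (h : ∀ w m, a ≤ w → w < b → Gap S w m → m = q) : ∃ k, b = a + k * q ∧ GapRun S q a k := by
  induction b using Nat.strong_induction_on with
  | _ b ih =>
    rcases hab.eq_or_lt with rfl | hlt
    · exact ⟨0, by simp, fun l hl => absurd hl l.not_lt_zero⟩
    · obtain ⟨w, m, haw, rfl, hg⟩ := exists_gap_before ha hb hlt
      have hwb : w < w + m := Nat.lt_add_of_pos_right hg.pos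
      obtain rfl := h w m haw hwb hg
      obtain ⟨k, rfl, hk⟩ := ih w hwb hg.start haw fun v l h1 h2 => h v l h1 (h2.trans hwb)
      refine ⟨k + 1, by ring, fun l hl => ?_⟩
      rcases (Nat.lt_succ_iff.1 hl).eq_or_lt with rfl | hlk
      · exact hg
      · exact hk l hlk

theorem exists_gap_gapRun (hi : Gap S a n) (hu : u ∈ S) (hau : a < u)
    (h : ∀ w m, w < u → Gap S w m → m = q ∨ m = n) :
    ∃ g k, Gap S g n ∧ u = g + n + k * q ∧ GapRun S q (g + n) k := by
  classical
  set g := Nat.findGreatest (Gap S · n) (u - 1)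
  have hg : Gap S g n := Nat.findGreatest_spec (P := (Gap S · n)) (by omega : a ≤ u - 1) hi
  have hgu : g ≤ u - 1 := Nat.findGreatest_le (u - 1)
  obtain ⟨k, hk, hrun⟩ := exists_gapRun (q := q) hg.last hu (hg.le_of_lt hu (by omega))
    fun w m hgw hwu hw => (h w m hwu hw).resolve_right fun hm =>
      Nat.findGreatest_is_greatest (P := (Gap S · n)) (n := u - 1)
        (by have := hg.pos; omega) (by omega) (hm ▸ hw)
  exact ⟨g, k, hg, hk, hrun⟩

end Gaps

/-! ### Difference tables -/

section Difference

variable {R : Type*} [CommRing R]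

/-- In the table `ν`, indexed from `1`, each column is minus the forward difference of the
preceding one. -/
structure IsDifferenceTable (ν : ℕ → ℕ → R) : Prop where
  apply_succ : ∀ {i j}, 1 ≤ i → 1 ≤ j → ν i (j + 1) = ν i j - ν (i + 1) j

namespace IsDifferenceTable

variable {ν : ℕ → ℕ → R} {i l : ℕ}

theorem apply_add_eq_fwdDiff_iter (h : IsDifferenceTable ν) (hl : 1 ≤ l) (k i : ℕ) :
    ν (i + 1) (l + k) = (-1) ^ k * (fwdDiff 1)^[k] (fun i => ν (i + 1) l) i := by
  induction k generalizing i with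
  | zero => simp
  | succ k ih =>
    rw [← add_assoc, h.apply_succ (by omega) (by omega), ih, ih, Function.iterate_succ_apply',
      fwdDiff]
    ring

theorem apply_add (h : IsDifferenceTable ν) (hi : 1 ≤ i) (hl : 1 ≤ l) (k : ℕ) :
    ν i (l + k) = ∑ j ∈ Finset.range (k + 1), (-1) ^ j * (k.choose j : R) * ν (i + j) l := by
  obtain ⟨i, rfl⟩ := Nat.exists_eq_add_of_le' hi
  rw [h.apply_add_eq_fwdDiff_iter hl, fwdDiff_iter_eq_sum_shift, Finset.mul_sum]
  refine Finset.sum_congr rfl fun j hj => ?_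
  obtain ⟨c, rfl⟩ := Nat.exists_eq_add_of_le (Finset.mem_range_succ_iff.1 hj)
  have sign : (-1 : R) ^ (j + c) * (-1) ^ c = (-1) ^ j := by
    rw [pow_add, mul_assoc, ← mul_pow, neg_one_mul, neg_neg, one_pow, mul_one]
  rw [← sign, zsmul_eq_mul, Nat.add_sub_cancel_left, show i + j • 1 + 1 = i + 1 + j by simp; ring]
  push_cast
  ring

theorem apply_add_of_const_between (h : IsDifferenceTable ν) {b : ℕ} {c : R} (hi : 1 ≤ i)
    (hl : 1 ≤ l) (hb : 1 ≤ b) (hc : ∀ j, i < j → j < i + b → ν j l = c) :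
    ν i (l + b) = (ν i l - c) + (-1) ^ b * (ν (i + b) l - c) := by
  induction b, hb using Nat.le_induction generalizing i with
  | base => rw [h.apply_succ hi hl]; ring
  | succ b hb ih =>
    rw [← add_assoc, h.apply_succ hi (by omega), ih hi fun j h1 h2 => hc j h1 (by omega),
      ih (by omega) fun j h1 h2 => hc j (by omega) (by omega), hc (i + b) (by omega) (by omega),
      hc (i + 1) (by omega) (by omega), show i + 1 + b = i + (b + 1) by ring]
    ring

theorem apply_add_prime_pow (h : IsDifferenceTable ν) {p : ℕ} [Fact p.Prime] [CharP R p]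
    (hp2 : p ≠ 2) (hi : 1 ≤ i) (hl : 1 ≤ l) (t : ℕ) :
    ν i (l + p ^ t) = ν i l - ν (i + p ^ t) l := by
  have hp : p.Prime := Fact.out
  have hodd : Odd (p ^ t) := (hp.odd_of_ne_two hp2).pow
  rw [h.apply_add hi hl, Finset.sum_range_succ, Finset.sum_eq_single 0]
  · simp [hodd.neg_one_pow, sub_eq_add_neg]
  · intro j hj hj0
    rw [(CharP.cast_eq_zero_iff R p _).2
      (hp.dvd_choose_pow hj0 (Finset.mem_range.1 hj).ne), mul_zero, zero_mul]
  · exact fun h0 => absurd (Finset.mem_range.2 (pow_pos hp.pos t)) h0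

theorem apply_two_mul_prime_pow (h : IsDifferenceTable ν) {p : ℕ} [Fact p.Prime] [CharP R p]
    (hp2 : p ≠ 2) (hi : 1 ≤ i) (t : ℕ) :
    ν i (2 * p ^ t) = ν i (p ^ t) - ν (i + p ^ t) (p ^ t) := by
  rw [two_mul, h.apply_add_prime_pow hp2 hi (Nat.pow_pos (Nat.Prime.pos Fact.out))]

end IsDifferenceTable

end Difference

/-! ### Structure constants -/

section Constants

variable {F : Type*} [Field F]

/-- The relations between the structure constants `[v_i, v_j] = ν i j • v_{i+j}` of an algebra of
maximal class with two distinct two-step centralizers, spanned by `y` and `x`, with respect to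
`v_1 = y`, `v_{i+1} = [v_i, x + y]`. Here `S` is the set of the `i ≥ 2` such that `x` centralizes
`v_i`, so that `[v_i, y]` is `v_{i+1}` if `i ∈ S` and `0` otherwise. -/
structure IsStructureConstants (S : Set ℕ) (ν : ℕ → ℕ → F) : Prop extends
    IsDifferenceTable ν where
  skew : ∀ {i j}, 1 ≤ i → 1 ≤ j → ν i j = -ν j i
  two_lt : ∀ {i}, i ∈ S → 2 < i
  apply_one : ∀ {i}, 1 ≤ i → ν i 1 = S.indicator 1 i
  leibniz : ∀ {i j}, 1 ≤ i → 1 ≤ j → S.indicator 1 (i + j) * ν i j =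
    S.indicator 1 i * ν (i + 1) j + S.indicator 1 j * ν i (j + 1)

namespace IsStructureConstants

variable {S : Set ℕ} {ν : ℕ → ℕ → F} {i j k a l m n p q t u w : ℕ}

theorem pos (h : IsStructureConstants S ν) (hi : i ∈ S) : 1 ≤ i :=
  Nat.one_le_of_lt (h.two_lt hi)

theorem apply_eq_zero_of_add_mem (h : IsStructureConstants S ν) (hi : 1 ≤ i) (hj : 1 ≤ j)
    (hiS : i ∉ S) (hjS : j ∉ S) (hij : i + j ∈ S) : ν i j = 0 := by
  simpa [hiS, hjS, hij] using h.leibniz hi hj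

theorem apply_succ_left_eq_zero_of_left_mem (h : IsStructureConstants S ν) (hj : 1 ≤ j)
    (hiS : i ∈ S) (hjS : j ∉ S) (hij : i + j ∉ S) : ν (i + 1) j = 0 := by
  simpa [hiS, hjS, hij] using (h.leibniz (h.pos hiS) hj).symm

theorem apply_succ_left_eq_of_left_mem (h : IsStructureConstants S ν) (hj : 1 ≤ j)
    (hiS : i ∈ S) (hjS : j ∉ S) (hij : i + j ∈ S) : ν (i + 1) j = ν i j := by
  simpa [hiS, hjS, hij] using (h.leibniz (h.pos hiS) hj).symm

theorem apply_eq_zero_of_mem_of_mem (h : IsStructureConstants S ν)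
    (hiS : i ∈ S) (hjS : j ∈ S) (hij : i + j ∉ S) : ν i j = 0 := by
  simpa [hiS, hjS, hij, h.apply_succ (h.pos hiS) (h.pos hjS)] using
    (h.leibniz (h.pos hiS) (h.pos hjS)).symm

theorem apply_succ_left_eq_zero_of_right_mem (h : IsStructureConstants S ν) (hi : 1 ≤ i)
    (hiS : i ∉ S) (hjS : j ∈ S) (hij : i + j ∈ S) : ν (i + 1) j = 0 := by
  have := h.leibniz hi (h.pos hjS)
  simp only [hiS, hjS, hij, Set.indicator_of_mem, Set.indicator_of_notMem, not_false_eq_true,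
    Pi.one_apply, h.apply_succ hi (h.pos hjS)] at this
  linear_combination this

theorem apply_succ_left_eq_of_right_mem (h : IsStructureConstants S ν) (hi : 1 ≤ i)
    (hiS : i ∉ S) (hjS : j ∈ S) (hij : i + j ∉ S) : ν (i + 1) j = ν i j := by
  have := h.leibniz hi (h.pos hjS)
  simp only [hiS, hjS, hij, Set.indicator_of_mem, Set.indicator_of_notMem, not_false_eq_true,
    Pi.one_apply, h.apply_succ hi (h.pos hjS)] at this
  linear_combination this

theorem apply_left_eq_of_forall_notMem (h : IsStructureConstants S ν) {b : ℕ} (ha : 1 ≤ a)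
    (hab : a ≤ b) (hl : l ∈ S) (hS : ∀ i, a ≤ i → i < b → i ∉ S ∧ i + l ∉ S) : ν b l = ν a l := by
  induction b, hab using Nat.le_induction with
  | base => rfl
  | succ b hab ih =>
    obtain ⟨hb, hbl⟩ := hS b hab b.lt_succ_self
    rw [h.apply_succ_left_eq_of_right_mem (ha.trans hab) hb hl hbl]
    exact ih fun i h1 h2 => hS i h1 (by omega)

theorem apply_succ_of_unique_mem (h : IsStructureConstants S ν) (hi : 1 ≤ i) (ha : a ≤ k)
    (haS : i + a ∈ S) (huniq : ∀ j, i ≤ j → j ≤ i + k → j ≠ i + a → j ∉ S) :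
    ν i (k + 1) = (-1) ^ a * (k.choose a : F) := by
  rw [add_comm, h.apply_add hi le_rfl, Finset.sum_eq_single a, h.apply_one (by omega),
    Set.indicator_of_mem haS, Pi.one_apply, mul_one]
  · intro j hj hja
    rw [Finset.mem_range] at hj
    rw [h.apply_one (by omega), Set.indicator_of_notMem
      (huniq _ (by omega) (by omega) (by omega)), mul_zero]
  · exact fun hk => absurd (Finset.mem_range.2 (by omega)) hk

theorem apply_eq_zero_of_forall_notMem (h : IsStructureConstants S ν) (hi : 1 ≤ i) (hk : 1 ≤ k)
    (hS : ∀ j, i ≤ j → j < i + k → j ∉ S) : ν i k = 0 := by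
  obtain ⟨k, rfl⟩ := Nat.exists_eq_add_of_le hk
  rw [h.apply_add hi le_rfl]
  refine Finset.sum_eq_zero fun j hj => ?_
  rw [Finset.mem_range] at hj
  rw [h.apply_one (by omega), Set.indicator_of_notMem (hS _ (by omega) (by omega)), mul_zero]

section CharP

variable [Fact p.Prime] [CharP F p]

theorem apply_prime_pow_eq_one_of_unique_mem (h : IsStructureConstants S ν) (hi : 1 ≤ i)
    (hij : i ≤ j) (hji : j < i + p ^ t) (hj : j ∈ S)
    (huniq : ∀ k, i ≤ k → k < i + p ^ t → k ≠ j → k ∉ S) : ν i (p ^ t) = 1 := by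
  obtain ⟨a, rfl⟩ := Nat.exists_eq_add_of_le hij
  have := h.apply_succ_of_unique_mem (k := p ^ t - 1) hi (by omega) hj
    fun k h1 h2 h3 => huniq k h1 (by omega) h3
  rwa [Nat.sub_add_cancel (by omega),
    neg_one_pow_mul_choose_prime_pow_sub_one (by omega)] at this

end CharP

theorem even_of_isLeast (h : IsStructureConstants S ν) (hn : IsLeast S n) (h2 : (2 : F) ≠ 0) :
    Even n := by
  by_contra hodd
  obtain ⟨a, rfl⟩ := Nat.not_even_iff_odd.1 hodd
  have value : ν (a + 1) (a + 1) = (-1) ^ a * (a.choose a : F) :=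
    h.apply_succ_of_unique_mem (by omega) le_rfl
      (by convert hn.1 using 1; ring) fun j _ _ hj hjS => by have := hn.2 hjS; omega
  have skew : ν (a + 1) (a + 1) = -ν (a + 1) (a + 1) := h.skew (by omega) (by omega)
  have : (2 : F) * ν (a + 1) (a + 1) = 0 := by linear_combination skew
  simp [value, h2] at this

theorem exists_gap (h : IsStructureConstants S ν) (hn : n ∈ S) (hu : u ∈ S) :
    ∃ m ≤ n, Gap S u m := by
  classical
  have next : ∃ m, 0 < m ∧ m ≤ n ∧ u + m ∈ S := by
    by_contra! hno
    have hpos := h.pos hn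
    have one := h.apply_succ_of_unique_mem (a := 0) (k := n - 1) (h.pos hu) (by omega) hu
      fun j h1 h2 h3 => by
        rw [show j = u + (j - u) by omega]
        exact hno _ (by omega) (by omega)
    rw [Nat.sub_add_cancel hpos, h.apply_eq_zero_of_mem_of_mem hu hn (hno n hpos le_rfl)] at one
    simp at one
  obtain ⟨hpos, hle, hlast⟩ := Nat.find_spec next
  refine ⟨Nat.find next, hle, hu, hpos, hlast, fun j huj hj hjS => ?_⟩
  exact Nat.find_min next (m := j - u) (by omega)
    ⟨by omega, by omega, by rwa [Nat.add_sub_cancel' huj.le]⟩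

theorem _root_.MaximalClass.Gap.le_of_mem (hg : Gap S u m) (h : IsStructureConstants S ν)
    (hn : n ∈ S) : m ≤ n := by
  obtain ⟨m', hle, hg'⟩ := h.exists_gap hn hg.start
  exact hg.unique hg' ▸ hle

theorem dvd_choose_of_gap [CharP F p] (h : IsStructureConstants S ν) (hg : Gap S (w + a) m)
    (hw : 1 ≤ w) (ha : 1 ≤ a) (hprev : ∀ j, w ≤ j → j < w + a → j ∉ S) (hma : m + a ∉ S) :
    p ∣ (m - 1 + a).choose a := by
  have hm := hg.pos
  have value : ν w (m - 1 + a + 1) = (-1) ^ a * ((m - 1 + a).choose a : F) :=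
    h.apply_succ_of_unique_mem hw (by omega) hg.start fun j h1 h2 h3 =>
      h3.lt_or_gt.elim (hprev j h1) fun h4 => hg.inner j h4 (by omega)
  rw [show m - 1 + a + 1 = m + a by omega, h.apply_eq_zero_of_add_mem hw (by omega)
    (hprev w le_rfl (by omega)) hma (by convert hg.last using 1; ring)] at value
  rw [← CharP.cast_eq_zero_iff F p]
  simpa using value.symm

theorem neg_one_pow_mul_choose_eq_neg_one (h : IsStructureConstants S ν) (hn : IsLeast S n)
    (hg : Gap S n m) (heven : Even n) (hl1 : 1 ≤ l) (hlm : l ≤ m) (hln : l ≤ n) :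
    (-1 : F) ^ l * ((n - 1).choose (l - 1) : F) = -1 := by
  have left : ν n (l - 1 + 1) = (-1) ^ 0 * ((l - 1).choose 0 : F) :=
    h.apply_succ_of_unique_mem (h.pos hn.1) (by omega) hn.1 fun j h1 h2 h3 =>
      hg.inner j (by omega) (by omega)
  have right : ν l (n - 1 + 1) = (-1) ^ (n - l) * ((n - 1).choose (n - l) : F) :=
    h.apply_succ_of_unique_mem hl1 (by omega) (by convert hn.1 using 1; omega) fun j _ h2 h3 hjS =>
      have := hn.2 hjS
      hg.inner j (by omega) (by omega) hjS
  have sign : (-1 : F) ^ (n - l) = (-1) ^ l := by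
    rw [neg_one_pow_eq_pow_mod_two, neg_one_pow_eq_pow_mod_two (n := l)]
    congr 1
    have := Nat.even_iff.1 heven
    omega
  rw [Nat.sub_add_cancel hl1] at left
  rw [Nat.sub_add_cancel (h.pos hn.1), h.skew hl1 (h.pos hn.1), left, sign,
    Nat.choose_symm_of_eq_add (by omega : n - 1 = n - l + (l - 1))] at right
  simpa using right.symm

theorem dvd_choose_of_isLeast [CharP F p] (h : IsStructureConstants S ν) (hn : IsLeast S n)
    (hg : Gap S n m) (heven : Even n) {b : ℕ} (hb1 : 1 ≤ b) (hb : b < m) : p ∣ n.choose b := by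
  have hmn := hg.le_of_mem h hn.1
  have at_b := h.neg_one_pow_mul_choose_eq_neg_one hn hg heven hb1 hb.le (by omega)
  have at_succ := h.neg_one_pow_mul_choose_eq_neg_one hn hg heven (l := b + 1) (by omega) hb
    (by omega)
  rw [Nat.add_sub_cancel, pow_succ] at at_succ
  rw [← CharP.cast_eq_zero_iff F p, ← (isUnit_neg_one.pow b).mul_right_eq_zero (a := (-1 : F) ^ b),
    Nat.choose_eq_choose_pred_add (by omega) hb1]
  push_cast
  linear_combination at_b - at_succ

section CharP

variable [Fact p.Prime] [CharP F p]

theorem exists_parameter (h : IsStructureConstants S ν) (hn : IsLeast S n) (hp2 : p ≠ 2) :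
    ∃ t, 1 ≤ t ∧ n = 2 * p ^ t ∧ Gap S n (p ^ t) := by
  have hp : p.Prime := Fact.out
  have hn2 := h.two_lt hn.1
  have heven : Even n := h.even_of_isLeast hn (Ring.two_ne_zero (ringChar.eq F p ▸ hp2))
  obtain ⟨m, hmn, hg⟩ := h.exists_gap hn.1 hn.1
  have hm := hg.pos
  obtain ⟨t, ht, hmt⟩ := exists_pow_dvd_of_forall_dvd_choose (p := p) (R := m) (by omega)
    fun b hb1 hb => h.dvd_choose_of_isLeast hn hg heven hb1 hb
  have h2t : 2 * p ^ t ∣ n :=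
    (Nat.coprime_two_left.2 (hp.odd_of_ne_two hp2).pow).mul_dvd_of_dvd_of_dvd heven.two_dvd ht
  have hle : 2 * p ^ t ≤ n := Nat.le_of_dvd (by omega) h2t
  obtain ⟨s, hs, hms⟩ := exists_pow_dvd_of_forall_dvd_choose_add (p := p) (m := m) (R := n - m)
    hm.ne' fun a ha1 ha => h.dvd_choose_of_gap (w := n - a)
      (by rwa [Nat.sub_add_cancel (by omega)]) (by omega) ha1
      (fun j _ hj hjS => by have := hn.2 hjS; omega) (fun hS => by have := hn.2 hS; omega)
  have hsm : p ^ s ≤ m := Nat.le_of_dvd hm hs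
  obtain rfl : m = p ^ t := by omega
  refine ⟨t, Nat.one_le_iff_ne_zero.2 ?_, by omega, hg⟩
  rintro rfl
  rw [pow_zero] at hle hms hsm
  omega

theorem gap_length (h : IsStructureConstants S ν) (hn : IsLeast S (2 * p ^ t)) (hg : Gap S u m) :
    p ^ t ≤ m ∧ (m = 2 * p ^ t ∨ ∃ s ≤ t, m + p ^ s = 2 * p ^ t) := by
  have hp : p.Prime := Fact.out
  have hq : 0 < p ^ t := pow_pos hp.pos t
  induction u using Nat.strong_induction_on generalizing m with
  | _ u ih =>
    have hm := hg.pos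
    have hmn := hg.le_of_mem h hn.1
    have hnu := hn.2 hg.start
    have hprev : ∀ j, u < j + p ^ t → j < u → j ∉ S := by
      intro j h1 h2 hj
      obtain ⟨w, l, hjw, rfl, hg'⟩ := exists_gap_before hj hg.start h2
      have := (ih w (Nat.lt_add_of_pos_right hg'.pos) hg').1
      omega
    obtain ⟨s, hs, hms⟩ := exists_pow_dvd_of_forall_dvd_choose_add (p := p) (m := m)
      (R := min (p ^ t) (2 * p ^ t - m)) hm.ne'
      fun a ha1 ha => h.dvd_choose_of_gap (w := u - a)
        (by rwa [Nat.sub_add_cancel (by omega)]) (by omega) ha1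
        (fun j h1 h2 => hprev j (by omega) (by omega)) (fun hS => by have := hn.2 hS; omega)
    have hsm : p ^ s ≤ m := Nat.le_of_dvd hm hs
    refine ⟨by omega, hmn.eq_or_lt.imp_right fun hlt => ?_⟩
    have hst : s ≤ t := le_of_pow_lt_two_mul_pow hp.two_le (by omega)
    have hdvd : p ^ s ∣ 2 * p ^ t - m := Nat.dvd_sub ((pow_dvd_pow p hst).mul_left 2) hs
    have := Nat.le_of_dvd (by omega) hdvd
    exact ⟨s, hst, by omega⟩

end CharP

theorem apply_succ_right_eq_zero_of_left_mem (h : IsStructureConstants S ν) (hj : 1 ≤ j)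
    (hiS : i ∈ S) (hjS : j ∉ S) (hij : i + j ∈ S) : ν i (j + 1) = 0 := by
  rw [h.apply_succ (h.pos hiS) hj, h.apply_succ_left_eq_of_left_mem hj hiS hjS hij, sub_self]

theorem apply_succ_right_eq_zero_of_right_mem (h : IsStructureConstants S ν) (hi : 1 ≤ i)
    (hiS : i ∉ S) (hjS : j ∈ S) (hij : i + j ∉ S) : ν i (j + 1) = 0 := by
  rw [h.apply_succ hi (h.pos hjS), h.apply_succ_left_eq_of_right_mem hi hiS hjS hij, sub_self]

theorem apply_right_eq_of_forall_notMem (h : IsStructureConstants S ν) {b : ℕ} (hl : 1 ≤ l)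
    (hlb : l ≤ b) (hi : i ∈ S) (hS : ∀ j, l ≤ j → j < b → j ∉ S ∧ i + j ∉ S) : ν i b = ν i l := by
  induction b, hlb using Nat.le_induction with
  | base => rfl
  | succ b hlb ih =>
    obtain ⟨hb, hib⟩ := hS b hlb b.lt_succ_self
    rw [h.apply_succ (h.pos hi) (hl.trans hlb),
      h.apply_succ_left_eq_zero_of_left_mem (hl.trans hlb) hi hb hib, sub_zero]
    exact ih fun j h1 h2 => hS j h1 (by omega)

section CharP

variable [Fact p.Prime] [CharP F p]

theorem false_of_short_long {e g : ℕ} (h : IsStructureConstants S ν) (hp2 : p ≠ 2)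
    (hqm : p ^ t < m) (hmq : m < 2 * p ^ t) (hm : Odd m) (he : Gap S e (p ^ t))
    (he' : ∀ j, e + p ^ t < j → j < e + 2 * p ^ t → j ∉ S) (hg : g ∈ S) (hgm : g + m ∉ S)
    (hgap : Gap S (e + g) m) (hν : ν (g + p ^ t) e = -1) : False := by
  have hq : Odd (p ^ t) := ((Fact.out : p.Prime).odd_of_ne_two hp2).pow
  have hq0 := he.pos
  have hg1 := h.pos hg
  have he1 := h.pos he.start
  have inner : ∀ j, e < j → j < e + m → j + g ∉ S := fun j h1 h2 =>
    hgap.inner _ (by omega) (by omega)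
  have zero : ∀ j, e < j → j ≤ e + p ^ t → ν j g = 0 := fun j h1 h2 => by
    rw [← h.apply_left_eq_of_forall_notMem (by omega) h2 hg fun i h3 h4 =>
      ⟨he.inner i (by omega) h4, inner i (by omega) (by omega)⟩]
    exact h.apply_eq_zero_of_mem_of_mem he.last hg (inner _ (by omega) (by omega))
  have one : ν e g = 1 := by
    have := h.apply_add_prime_pow hp2 he1 hg1 t
    rw [zero _ (by omega) le_rfl, sub_zero, h.skew he1 (by omega), hν, neg_neg] at this
    exact this.symm
  have const : ∀ j, e + p ^ t < j → j ≤ e + m → ν j g = ν (e + p ^ t + 1) g := fun j h1 h2 =>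
    h.apply_left_eq_of_forall_notMem (by omega) h1 hg fun i h3 h4 =>
      ⟨he' i (by omega) (by omega), inner i (by omega) (by omega)⟩
  have zero_end : ν (e + m + 1) g = 0 :=
    h.apply_succ_left_eq_zero_of_right_mem (by omega) (he' _ (by omega) (by omega)) hg
      (by convert hgap.last using 1; ring)
  obtain ⟨b, rfl⟩ := Nat.exists_eq_add_of_lt hqm
  have hb : Even (b + 1) := (Nat.odd_add.1 (add_assoc (p ^ t) b 1 ▸ hm)).1 hq
  have near : ν e (g + (b + 1 + 1)) = 1 := by
    rw [h.apply_add_of_const_between (c := 0) he1 hg1 (by omega)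
      fun j h1 h2 => zero j h1 (by omega), one, zero _ (by omega) (by omega)]
    ring
  have far : ν (e + p ^ t) (g + (b + 1 + 1)) = 0 := by
    rw [h.apply_add_of_const_between (by omega) hg1 (by omega)
      fun j h1 h2 => const j h1 (by omega), zero _ (by omega) le_rfl, pow_succ, hb.neg_one_pow,
      show e + p ^ t + (b + 1 + 1) = e + (p ^ t + b + 1) + 1 by ring, zero_end]
    ring
  have := h.apply_succ_right_eq_zero_of_left_mem (by omega) he.start hgm
    (by convert hgap.last using 1; ring)
  rw [show g + (p ^ t + b + 1) + 1 = g + (b + 1 + 1) + p ^ t by ring,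
    h.apply_add_prime_pow hp2 he1 (by omega), near, far, sub_zero] at this
  exact one_ne_zero this

theorem eq_two_of_long_long {e g : ℕ} (h : IsStructureConstants S ν) (hp2 : p ≠ 2)
    (hqm : p ^ t < m) (hm : Odd m) (he : e ∈ S) (he' : ∀ j, e < j → j ≤ e + m → j ∉ S)
    (hg : g ∈ S) (hgm : g + m ∉ S) (hgap : Gap S (e + g) m) (hν : ν (g + p ^ t) e = -1) :
    ν e g = 2 := by
  have hq : 1 ≤ p ^ t := Nat.pow_pos (Nat.Prime.pos Fact.out)
  have hg1 := h.pos hg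
  have he1 := h.pos he
  have const : ∀ j, e < j → j ≤ e + m → ν j g = ν (e + 1) g := fun j h1 h2 =>
    h.apply_left_eq_of_forall_notMem (by omega) h1 hg fun i h3 h4 =>
      ⟨he' i (by omega) (by omega), hgap.inner _ (by omega) (by omega)⟩
  have zero_end : ν (e + m + 1) g = 0 :=
    h.apply_succ_left_eq_zero_of_right_mem (by omega) (he' _ (by omega) le_rfl) hg
      (by convert hgap.last using 1; ring)
  have sub_eq_one : ν e g - ν (e + 1) g = 1 := by
    rw [← const (e + p ^ t) (by omega) (by omega), ← h.apply_add_prime_pow hp2 he1 hg1,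
      h.skew he1 (by omega), hν, neg_neg]
  have sub_eq_const : ν e (g + (m + 1)) = ν e g - ν (e + 1) g - ν (e + 1) g := by
    rw [h.apply_add_of_const_between he1 hg1 (by omega) fun j h1 h2 => const j h1 (by omega),
      ← add_assoc e, zero_end, hm.add_one.neg_one_pow]
    ring
  rw [← add_assoc, h.apply_succ_right_eq_zero_of_left_mem (by omega) he hgm
    (by convert hgap.last using 1; ring)] at sub_eq_const
  linear_combination 2 * sub_eq_one + sub_eq_const

end CharP

end IsStructureConstants

/-- The constituents of lengths `2q, q^r, 2q` at the beginning, and those of lengths `2q, q^k, m`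
starting at the element `g` of `S`. The proof that every length is `q` or `2q` consists in showing
that there is no such pattern with `q < m < 2q`. -/
structure Pattern (S : Set ℕ) (q r k m g : ℕ) : Prop where
  isLeast : IsLeast S (2 * q)
  first_run : GapRun S q (2 * q) r
  first_long : Gap S (2 * q + r * q) (2 * q)
  long : Gap S g (2 * q)
  run : GapRun S q (g + 2 * q) k
  last : Gap S (g + 2 * q + k * q) m
  lt_last : q < m
  last_lt : m < 2 * q

namespace Pattern

variable {S : Set ℕ} {ν : ℕ → ℕ → F} {a j l q r k m g : ℕ}

theorem first_run_mem (hP : Pattern S q r k m g) (hl : l ≤ r) : 2 * q + l * q ∈ S :=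
  hP.first_run.mem hP.first_long.start hl

theorem run_mem (hP : Pattern S q r k m g) (hl : l ≤ k) : g + 2 * q + l * q ∈ S :=
  hP.run.mem hP.last.start hl

theorem run_notMem (hP : Pattern S q r k m g) (hl : l ≤ k) (hj : g + 2 * q + l * q < j)
    (hj' : j < g + 2 * q + l * q + q) : j ∉ S := by
  rcases hl.eq_or_lt with rfl | hl
  · exact hP.last.inner j hj (by have := hP.lt_last; omega)
  · exact (hP.run l hl).inner j hj hj'

theorem long_notMem (hP : Pattern S q r k m g) (hj : 0 < j) (hj' : j < 2 * q) : g + j ∉ S :=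
  hP.long.inner _ (by omega) (by omega)

theorem pos (hP : Pattern S q r k m g) : 0 < q := by
  have := hP.long.pos
  omega

theorem apply_eq_zero_of_run (hP : Pattern S q r k m g) (h : IsStructureConstants S ν)
    (hal : a + l + 2 = k) (hlr : l ≤ r) :
    ν (g + 2 * q + a * q + 1) (2 * q + l * q) = 0 := by
  have hq := hP.pos
  have ha := add_one_mul a q
  have hk : k * q = a * q + l * q + 2 * q := by rw [← hal]; ring
  have hS := hP.first_run_mem hlr
  rw [← h.apply_left_eq_of_forall_notMem (b := g + 2 * q + (a + 1) * q) (by omega)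
    (by omega) hS fun j _ _ => ⟨hP.run_notMem (l := a) (by omega) (by omega) (by omega),
      hP.run_notMem le_rfl (by omega) (by omega)⟩]
  have hm := hP.lt_last
  exact h.apply_eq_zero_of_mem_of_mem (hP.run_mem (by omega)) hS
    (hP.last.inner _ (by omega) (by omega))

theorem apply_first_run_last_eq_zero (hP : Pattern S q r (r + 1) m g)
    (h : IsStructureConstants S ν) (hj : g + q < j) (hj' : j ≤ g + 2 * q) :
    ν j (2 * q + r * q) = 0 := by
  have hq := hP.pos
  have hm := hP.lt_last
  have hr := add_one_mul r q
  have he := hP.first_long.start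
  rw [h.apply_left_eq_of_forall_notMem (by omega) hj he fun i _ _ =>
    ⟨hP.long.inner i (by omega) (by omega), hP.last.inner _ (by omega) (by omega)⟩]
  exact h.apply_succ_left_eq_zero_of_right_mem (by omega) (hP.long_notMem hq (by omega)) he
    (by convert hP.last.start using 1; omega)

variable {p t : ℕ} [Fact p.Prime] [CharP F p]

theorem const_mid (hP : Pattern S (p ^ t) r k m g) (h : IsStructureConstants S ν) (hp2 : p ≠ 2)
    (hlk : l ≤ k) (hlr : l ≤ r + 1) : ν (g + p ^ t) (2 * p ^ t + l * p ^ t) = -1 := by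
  have hq := hP.pos
  induction l with
  | zero =>
    have empty : ν (g + p ^ t) (p ^ t) = 0 :=
      h.apply_eq_zero_of_forall_notMem (by omega) hq fun j _ _ =>
        hP.long.inner j (by omega) (by omega)
    have one : ν (g + p ^ t + p ^ t) (p ^ t) = 1 :=
      h.apply_prime_pow_eq_one_of_unique_mem (j := g + 2 * p ^ t) (by omega) (by omega) (by omega)
        hP.long.last fun j _ _ _ => hP.run_notMem (Nat.zero_le k) (by omega) (by omega)
    rw [zero_mul, add_zero, h.apply_two_mul_prime_pow hp2 (by omega), empty, one, zero_sub]
  | succ l ih =>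
    have hl := add_one_mul l (p ^ t)
    have hS := hP.first_run_mem (l := l) (by omega)
    have hmem := hP.run_mem hlk
    have zero : ν (g + p ^ t + 1) (2 * p ^ t + l * p ^ t) = 0 :=
      h.apply_succ_left_eq_zero_of_right_mem (by omega)
        (hP.long_notMem hq (by omega)) hS (by convert hmem using 1; omega)
    have zero' : ν (g + p ^ t + p ^ t) (2 * p ^ t + l * p ^ t) = 0 :=
      zero ▸ h.apply_left_eq_of_forall_notMem (by omega) (by omega) hS fun j _ _ =>
        ⟨hP.long.inner j (by omega) (by omega), hP.run_notMem hlk (by omega) (by omega)⟩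
    rw [hl, ← add_assoc, h.apply_add_prime_pow hp2 (by omega) (by omega), zero',
      ih (by omega) (by omega), sub_zero]

theorem k_le_r_add_one (hP : Pattern S (p ^ t) r k m g) (h : IsStructureConstants S ν)
    (hp2 : p ≠ 2) : k ≤ r + 1 := by
  by_contra! hk
  have hq := hP.pos
  have hr := add_one_mul r (p ^ t)
  have hr' := add_one_mul (r + 1) (p ^ t)
  have value := hP.const_mid h hp2 hk.le le_rfl
  rw [h.apply_eq_zero_of_add_mem (by omega) (by omega) (hP.long_notMem hq (by omega))
    (hP.first_long.inner _ (by omega) (by omega))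
    (by convert hP.run_mem (l := r + 1 + 1) hk using 1; omega)] at value
  exact neg_ne_zero.2 one_ne_zero value.symm

theorem r_le_k (hP : Pattern S (p ^ t) r k m g) (h : IsStructureConstants S ν) (hp2 : p ≠ 2)
    (hm : Odd m) : r ≤ k := by
  by_contra! hk
  have hk' := add_one_mul k (p ^ t)
  have hmq := hP.last_lt
  refine h.false_of_short_long hp2 hP.lt_last hmq hm (hP.first_run k hk) (fun j h1 h2 => ?_)
    hP.long.start (hP.long_notMem hP.last.pos hmq) ?_ (hP.const_mid h hp2 le_rfl (by omega))
  · rcases (show k + 1 ≤ r from hk).eq_or_lt with rfl | hlt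
    · exact hP.first_long.inner j (by omega) (by omega)
    · exact (hP.first_run (k + 1) hlt).inner j (by omega) (by omega)
  · convert hP.last using 1
    ring

theorem const_start (hP : Pattern S (p ^ t) r k m g) (h : IsStructureConstants S ν) (hp2 : p ≠ 2)
    (hlk : l ≤ k) (hlr : l ≤ r) : ν g (2 * p ^ t + l * p ^ t) = l + 1 := by
  have hq := hP.pos
  have hg := h.pos hP.long.start
  induction l with
  | zero =>
    have one : ν g (p ^ t) = 1 :=
      h.apply_prime_pow_eq_one_of_unique_mem hg le_rfl (by omega) hP.long.start
        fun j _ _ _ => hP.long.inner j (by omega) (by omega)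
    have empty : ν (g + p ^ t) (p ^ t) = 0 :=
      h.apply_eq_zero_of_forall_notMem (by omega) hq fun j _ _ =>
        hP.long.inner j (by omega) (by omega)
    rw [zero_mul, add_zero, h.apply_two_mul_prime_pow hp2 hg, one, empty]
    simp
  | succ l ih =>
    rw [add_one_mul l, ← add_assoc, h.apply_add_prime_pow hp2 hg (by omega),
      ih (by omega) (by omega), hP.const_mid h hp2 (by omega) (by omega)]
    push_cast
    ring

theorem apply_eq_neg_one_pow_of_run (hP : Pattern S (p ^ t) r k m g)
    (h : IsStructureConstants S ν) (hp2 : p ≠ 2) (hal : a + l + 1 = k) (hlr : l ≤ r) :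
    ν (g + 2 * p ^ t + a * p ^ t + 1) (2 * p ^ t + l * p ^ t) = (-1) ^ l := by
  have hq := hP.pos
  have ha := add_one_mul a (p ^ t)
  induction l generalizing a with
  | zero =>
    obtain rfl : k = a + 1 := hal.symm
    have hm := hP.lt_last
    have one : ν (g + 2 * p ^ t + a * p ^ t + 1) (p ^ t) = 1 :=
      h.apply_prime_pow_eq_one_of_unique_mem (by omega) (by omega) (by omega) (hP.run_mem le_rfl)
        fun j _ _ _ => hP.run_notMem (l := a) (by omega) (by omega) (by omega)
    have empty : ν (g + 2 * p ^ t + a * p ^ t + 1 + p ^ t) (p ^ t) = 0 :=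
      h.apply_eq_zero_of_forall_notMem (by omega) hq fun j _ _ =>
        hP.last.inner j (by omega) (by omega)
    rw [zero_mul, add_zero, h.apply_two_mul_prime_pow hp2 (by omega), one, empty]
    simp
  | succ l ih =>
    rw [add_one_mul l, ← add_assoc (2 * p ^ t), h.apply_add_prime_pow hp2 (by omega) (by omega),
      hP.apply_eq_zero_of_run h (by omega) (by omega), add_right_comm _ 1,
      add_assoc (g + 2 * p ^ t), ← ha, ih (by omega) (by omega) (add_one_mul _ _), pow_succ]
    ring

theorem apply_eq_neg_one_pow_mul_of_run (hP : Pattern S (p ^ t) r k m g)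
    (h : IsStructureConstants S ν) (hp2 : p ≠ 2)
    (hnext : ∀ j, g + 2 * p ^ t + k * p ^ t + m < j → j < g + 2 * p ^ t + k * p ^ t + m + p ^ t →
      j ∉ S) (hal : a + l = k) (hlr : l ≤ r) :
    ν (g + 2 * p ^ t + a * p ^ t + 1) (2 * p ^ t + l * p ^ t) = (-1) ^ (l + 1) * (l + 1) := by
  have hq := hP.pos
  have ha := add_one_mul a (p ^ t)
  induction l generalizing a with
  | zero =>
    obtain rfl : k = a := hal.symm
    have hm := hP.lt_last
    have hm' := hP.last_lt
    have empty : ν (g + 2 * p ^ t + k * p ^ t + 1) (p ^ t) = 0 :=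
      h.apply_eq_zero_of_forall_notMem (by omega) hq fun j _ _ =>
        hP.last.inner j (by omega) (by omega)
    have one : ν (g + 2 * p ^ t + k * p ^ t + 1 + p ^ t) (p ^ t) = 1 :=
      h.apply_prime_pow_eq_one_of_unique_mem (by omega) (by omega) (by omega) hP.last.last
        fun j h1 h2 h3 => h3.lt_or_gt.elim (hP.last.inner j (by omega))
          fun h4 => hnext j h4 (by omega)
    rw [zero_mul, add_zero, h.apply_two_mul_prime_pow hp2 (by omega), one, empty]
    simp
  | succ l ih =>
    rw [add_one_mul l, ← add_assoc (2 * p ^ t), h.apply_add_prime_pow hp2 (by omega) (by omega),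
      hP.apply_eq_neg_one_pow_of_run h hp2 (by omega) (by omega), add_right_comm _ 1,
      add_assoc (g + 2 * p ^ t), ← ha, ih (by omega) (by omega) (add_one_mul _ _)]
    push_cast
    ring

theorem apply_eq_neg_one_pow_of_first_run (hP : Pattern S (p ^ t) r k m g)
    (h : IsStructureConstants S ν) (hp2 : p ≠ 2) (hal : a + l = r) :
    ν (2 * p ^ t + a * p ^ t) (2 * p ^ t + l * p ^ t) = (-1) ^ l := by
  have hq := hP.pos
  induction l generalizing a with
  | zero =>
    obtain rfl : r = a := hal.symm
    have one : ν (2 * p ^ t + r * p ^ t) (p ^ t) = 1 :=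
      h.apply_prime_pow_eq_one_of_unique_mem (by omega) le_rfl (by omega) hP.first_long.start
        fun j _ _ _ => hP.first_long.inner j (by omega) (by omega)
    have empty : ν (2 * p ^ t + r * p ^ t + p ^ t) (p ^ t) = 0 :=
      h.apply_eq_zero_of_forall_notMem (by omega) hq fun j _ _ =>
        hP.first_long.inner j (by omega) (by omega)
    rw [zero_mul, add_zero, h.apply_two_mul_prime_pow hp2 (by omega), one, empty]
    simp
  | succ l ih =>
    have hr : r * p ^ t = a * p ^ t + l * p ^ t + p ^ t := by rw [← hal]; ring
    have zero : ν (2 * p ^ t + a * p ^ t) (2 * p ^ t + l * p ^ t) = 0 :=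
      h.apply_eq_zero_of_mem_of_mem (hP.first_run_mem (by omega)) (hP.first_run_mem (by omega))
        (hP.first_long.inner _ (by omega) (by omega))
    rw [add_one_mul l, ← add_assoc (2 * p ^ t), h.apply_add_prime_pow hp2 (by omega) (by omega),
      zero, add_assoc (2 * p ^ t) _ (p ^ t), ← add_one_mul a, ih (by omega), pow_succ]
    ring

theorem odd_first_run (hP : Pattern S (p ^ t) r k m g) (h : IsStructureConstants S ν)
    (hp2 : p ≠ 2) : Odd r := by
  by_contra hne
  obtain ⟨c, rfl⟩ := Nat.not_odd_iff_even.1 hne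
  have hpos : 1 ≤ 2 * p ^ t + c * p ^ t := by have := hP.pos; omega
  have skew := h.skew hpos hpos
  rw [hP.apply_eq_neg_one_pow_of_first_run h hp2 rfl] at skew
  have : (2 : F) * (-1) ^ c = 0 := by linear_combination skew
  simp [Ring.two_ne_zero (ringChar.eq F p ▸ hp2)] at this

theorem k_ne_r_add_one (hP : Pattern S (p ^ t) r k m g) (h : IsStructureConstants S ν)
    (hp2 : p ≠ 2) : k ≠ r + 1 := by
  rintro rfl
  have hq := hP.pos
  have hm := hP.lt_last
  have hm' := hP.last_lt
  have hr := add_one_mul r (p ^ t)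
  have zero : ∀ j, g + p ^ t < j → j ≤ g + 2 * p ^ t → ν j (2 * p ^ t + r * p ^ t) = 0 :=
    fun j => hP.apply_first_run_last_eq_zero h
  have neg_one : ν (g + 2 * p ^ t + 1) (2 * p ^ t + r * p ^ t) = -1 := by
    simpa [(hP.odd_first_run h hp2).neg_one_pow] using
      hP.apply_eq_neg_one_pow_of_run h hp2 (a := 0) (zero_add (r + 1)) le_rfl
  have left : ν (g + p ^ t) (2 * p ^ t + r * p ^ t + (m - p ^ t)) = -1 := by
    rw [h.apply_add_of_const_between (c := 0) (by omega) (by omega) (by omega)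
      fun j _ _ => zero j (by omega) (by omega), zero (g + p ^ t + (m - p ^ t)) (by omega)
      (by omega), hP.const_mid h hp2 (by omega) (by omega)]
    ring
  have right : ν (g + p ^ t + p ^ t) (2 * p ^ t + r * p ^ t + (m - p ^ t)) = 1 := by
    rw [h.apply_right_eq_of_forall_notMem (l := 2 * p ^ t + r * p ^ t + 1) (by omega) (by omega)
        (by convert hP.long.last using 1; omega) fun j _ _ =>
          ⟨hP.first_long.inner j (by omega) (by omega), hP.last.inner _ (by omega) (by omega)⟩,
      h.apply_succ (by omega) (by omega), zero _ (by omega) (by omega), add_assoc g, ← two_mul,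
      neg_one]
    ring
  have sub := h.apply_add_prime_pow hp2 (i := g + p ^ t)
    (l := 2 * p ^ t + r * p ^ t + (m - p ^ t)) (by omega) (by omega) t
  rw [left, right, h.apply_eq_zero_of_add_mem (by omega) (by omega)
    (hP.long_notMem hq (by omega)) (hP.first_long.inner _ (by omega) (by omega))
    (by convert hP.last.last using 1; omega)] at sub
  exact Ring.two_ne_zero (ringChar.eq F p ▸ hp2) (by linear_combination sub : (2 : F) = 0)

theorem apply_run_ne_zero (hP : Pattern S (p ^ t) r r m g) (h : IsStructureConstants S ν)
    (hp2 : p ≠ 2) (hm : Odd m)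
    (hnext : ∀ j, g + 2 * p ^ t + r * p ^ t + m < j → j < g + 2 * p ^ t + r * p ^ t + m + p ^ t →
      j ∉ S) : ν (g + 2 * p ^ t + 1) (2 * p ^ t + r * p ^ t) ≠ 0 := by
  have h2 : (2 : F) ≠ 0 := Ring.two_ne_zero (ringChar.eq F p ▸ hp2)
  have hmq := hP.last_lt
  have he := hP.first_long.start
  have two : ν (2 * p ^ t + r * p ^ t) g = 2 :=
    h.eq_two_of_long_long hp2 hP.lt_last hm he
      (fun j _ _ => hP.first_long.inner j (by omega) (by omega)) hP.long.start
      (hP.long_notMem hP.last.pos hmq) (by convert hP.last using 1; ring)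
      (hP.const_mid h hp2 le_rfl (by omega))
  rw [h.skew (h.pos he) (h.pos hP.long.start), hP.const_start h hp2 le_rfl le_rfl] at two
  have value := hP.apply_eq_neg_one_pow_mul_of_run h hp2 hnext (zero_add r) le_rfl
  rw [zero_mul, add_zero] at value
  rw [value]
  refine mul_ne_zero (pow_ne_zero _ (neg_ne_zero.2 one_ne_zero)) fun h0 => h2 ?_
  rw [← two, h0, neg_zero]

omit [Fact p.Prime] [CharP F p] in
theorem apply_right_eq_of_gap {c m' : ℕ} (hP : Pattern S q r r m g)
    (h : IsStructureConstants S ν) (hgap : Gap S (g + 2 * q + r * q + m) m')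
    (hc : 1 ≤ c) (hcm : c + 2 * q ≤ m + m') (hcq : c ≤ 2 * q) :
    ν (g + q + q) (2 * q + r * q + c) = -ν (g + 2 * q + 1) (2 * q + r * q) := by
  have hqm := hP.lt_last
  have hmq := hP.last_lt
  have he := hP.first_long.start
  have hg : g + 2 * q ∈ S := hP.long.last
  have zero : ν (g + 2 * q) (2 * q + r * q) = 0 := by
    rw [h.apply_left_eq_of_forall_notMem (a := g + m + 1) (by omega) (by omega) he fun j _ _ =>
      ⟨hP.long.inner j (by omega) (by omega), hgap.inner _ (by omega) (by omega)⟩]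
    exact h.apply_succ_left_eq_zero_of_right_mem (by omega) (hP.long_notMem hP.last.pos hmq) he
      (by convert hP.last.last using 1; ring)
  rw [add_assoc g, ← two_mul, h.apply_right_eq_of_forall_notMem (l := 2 * q + r * q + 1)
      (by omega) (by omega) hg fun j _ _ => ⟨hP.first_long.inner j (by omega) (by omega),
        hgap.inner _ (by omega) (by omega)⟩,
    h.apply_succ (h.pos hg) (h.pos he), zero, zero_sub]

theorem apply_right_eq_zero {c : ℕ} (hP : Pattern S (p ^ t) r r m g)
    (h : IsStructureConstants S ν) (hp2 : p ≠ 2) (hc : 1 ≤ c) (hcm : c + p ^ t ≤ m) :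
    ν (g + p ^ t) (2 * p ^ t + r * p ^ t + c) = 0 := by
  have hmq := hP.last_lt
  have he := hP.first_long.start
  have const : ∀ j, g + p ^ t ≤ j → j ≤ g + m → ν j (2 * p ^ t + r * p ^ t) = -1 := fun j h1 _ => by
    rw [← hP.const_mid h hp2 le_rfl (Nat.le_add_right r 1)]
    exact h.apply_left_eq_of_forall_notMem (by have := hP.pos; omega) h1 he fun i _ _ =>
      ⟨hP.long.inner i (by have := hP.pos; omega) (by omega),
        hP.last.inner _ (by have := hP.pos; omega) (by omega)⟩
  rw [h.apply_add_of_const_between (c := -1) (by omega) (h.pos he) hc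
    fun j _ _ => const j (by omega) (by omega), const _ le_rfl (by omega),
    const _ (by omega) (by omega)]
  ring

theorem k_ne_r {m' : ℕ} (hP : Pattern S (p ^ t) r k m g) (h : IsStructureConstants S ν)
    (hp2 : p ≠ 2) (hm : Odd m) (hgap : Gap S (g + 2 * p ^ t + k * p ^ t + m) m')
    (hm' : m' = p ^ t ∨ 3 * p ^ t < m + m') : k ≠ r := by
  rintro rfl
  have hq := hP.pos
  have hqm := hP.lt_last
  have hmq := hP.last_lt
  have hne := hP.apply_run_ne_zero h hp2 hm fun j h1 h2 => hgap.inner j h1 (by omega)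
  have hmem : g + p ^ t ∉ S := hP.long_notMem hq (by omega)
  set e := 2 * p ^ t + k * p ^ t
  have step : ∀ c, 1 ≤ c → c + 2 * p ^ t ≤ m + m' → c ≤ 2 * p ^ t →
      ν (g + p ^ t) (e + c + p ^ t) = ν (g + p ^ t) (e + c) + ν (g + 2 * p ^ t + 1) e := by
    intro c h1 h2 h3
    rw [h.apply_add_prime_pow hp2 (by omega) (by omega), hP.apply_right_eq_of_gap h hgap h1 h2 h3,
      sub_neg_eq_add]
  rcases hm' with rfl | hm'
  · have := step (m - p ^ t) (by omega) (by omega) (by omega)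
    rw [hP.apply_right_eq_zero h hp2 (by omega) (by omega), zero_add,
      h.apply_eq_zero_of_add_mem (by omega) (by omega) hmem
        (hP.first_long.inner _ (by omega) (by omega))
        (by convert hgap.last using 1; omega)] at this
    exact hne this.symm
  · have first := step 1 le_rfl (by omega) (by omega)
    have second := step (1 + p ^ t) (by omega) (by omega) (by omega)
    rw [hP.apply_right_eq_zero h hp2 le_rfl (by omega), zero_add] at first
    rw [← add_assoc, first, show e + 1 + p ^ t + p ^ t = e + 2 * p ^ t + 1 by ring,
      h.apply_succ_right_eq_zero_of_right_mem (by omega) hmem hP.first_long.last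
        (hgap.inner _ (by omega) (by omega))] at second
    exact mul_ne_zero (Ring.two_ne_zero (ringChar.eq F p ▸ hp2)) hne (by linear_combination -second)

theorem false (hP : Pattern S (p ^ t) r k m g) (h : IsStructureConstants S ν) (hp2 : p ≠ 2) :
    False := by
  have hp : p.Prime := Fact.out
  have hqm := hP.lt_last
  have hmq := hP.last_lt
  obtain ⟨s, hst, hs⟩ := (h.gap_length hP.isLeast hP.last).2.resolve_left hmq.ne
  have hm : Odd m := by
    obtain ⟨c, hc⟩ : Odd (p ^ s) := (hp.odd_of_ne_two hp2).pow
    exact Nat.odd_iff.2 (by omega)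
  have small : ∀ s' ≤ t, p ^ s' < p ^ t → 3 * p ^ s' ≤ p ^ t := fun s' _ hlt =>
    have h3 : 3 ≤ p := by have := hp.two_le; omega
    calc 3 * p ^ s' ≤ p * p ^ s' := Nat.mul_le_mul_right _ h3
      _ = p ^ (s' + 1) := by ring
      _ ≤ p ^ t := Nat.pow_le_pow_right hp.pos ((Nat.pow_lt_pow_iff_right hp.one_lt).1 hlt)
  have hsmall := small s hst (by omega)
  obtain ⟨m', -, hgap⟩ := h.exists_gap hP.isLeast.1 hP.last.last
  have hm' : m' = p ^ t ∨ 3 * p ^ t < m + m' := by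
    rcases (h.gap_length hP.isLeast hgap).2 with hlong | ⟨s', hst', hs'⟩
    · omega
    · rcases (Nat.pow_le_pow_right hp.pos hst').eq_or_lt with heq | hlt
      · omega
      · have := small s' hst' hlt
        omega
  have := hP.k_le_r_add_one h hp2
  have := hP.r_le_k h hp2 hm
  have := hP.k_ne_r_add_one h hp2
  have := hP.k_ne_r h hp2 hm hgap hm'
  omega

end Pattern

theorem exists_pattern {S : Set ℕ} {q i u m : ℕ} (hn : IsLeast S (2 * q))
    (hlong : Gap S i (2 * q)) (hshort : ∀ w l, w < i → Gap S w l → l = q) (hgap : Gap S u m)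
    (hprev : ∀ w l, w < u → Gap S w l → l = q ∨ l = 2 * q) (hqm : q < m) (hmq : m < 2 * q) :
    ∃ r k g, Pattern S q r k m g := by
  have hiu : i < u := by
    rcases lt_trichotomy i u with hlt | rfl | hgt
    · exact hlt
    · exact absurd (hgap.unique hlong) hmq.ne
    · exact absurd (hshort u m hgt hgap) hqm.ne'
  obtain ⟨r, rfl, hr⟩ := exists_gapRun hn.1 hlong.start (hn.2 hlong.start) fun w l _ => hshort w l
  obtain ⟨g, k, hg, rfl, hk⟩ := exists_gap_gapRun hlong hgap.start hiu hprev
  exact ⟨r, k, g, hn, hr, hlong, hg, hk, hgap, hqm, hmq⟩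

theorem IsStructureConstants.gap_short_or_long {S : Set ℕ} {ν : ℕ → ℕ → F} {p t i u m : ℕ}
    [Fact p.Prime] [CharP F p] (h : IsStructureConstants S ν) (hp2 : p ≠ 2)
    (hn : IsLeast S (2 * p ^ t)) (hlong : Gap S i (2 * p ^ t))
    (hshort : ∀ w l, w < i → Gap S w l → l = p ^ t) (hgap : Gap S u m) :
    m = p ^ t ∨ m = 2 * p ^ t := by
  induction u using Nat.strong_induction_on generalizing m with
  | _ u ih =>
    by_contra! hne
    have hqm := (h.gap_length hn hgap).1
    have hmq := hgap.le_of_mem h hn.1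
    obtain ⟨r, k, g, hP⟩ := exists_pattern hn hlong hshort hgap (fun w l hw => ih w hw)
      (by omega) (by omega)
    exact hP.false h hp2

theorem IsStructureConstants.apply_eq_zero_of_dvd_add {S : Set ℕ} {ν : ℕ → ℕ → F} {p i j : ℕ}
    [Fact p.Prime] [CharP F p] (h : IsStructureConstants S ν) (hS : ∀ u ∈ S, p ∣ u) (hi : 1 ≤ i)
    (hj : 1 ≤ j) (hpi : ¬p ∣ i) (hpij : p ∣ i + j) : ν i j = 0 := by
  obtain ⟨k, rfl⟩ := Nat.exists_eq_add_of_le hj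
  rw [h.apply_add hi le_rfl]
  refine Finset.sum_eq_zero fun l _ => ?_
  by_cases hl : i + l ∈ S
  · have hpil := hS _ hl
    have hlk : l ≡ 1 + k [MOD p] := Nat.ModEq.add_left_cancel' i
      ((Nat.modEq_zero_iff_dvd.2 hpil).trans (Nat.modEq_zero_iff_dvd.2 hpij).symm)
    cases l with
    | zero => exact absurd hpil hpi
    | succ l =>
      have hdvd : p ∣ k.choose (l + 1) :=
        dvd_choose_succ_of_modEq (Nat.ModEq.add_right_cancel' 1 (add_comm 1 k ▸ hlk))
          fun hpl => hpi ((Nat.dvd_add_left hpl).1 hpil)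
      rw [(CharP.cast_eq_zero_iff F p _).2 hdvd, mul_zero, zero_mul]
  · rw [h.apply_one (by omega), Set.indicator_of_notMem hl, mul_zero]

end Constants

/-! ### Structure constants when all exceptional weights are multiples of `p` -/

section InflationConstants

variable {F : Type*} [Field F] {S : Set ℕ} {ν : ℕ → ℕ → F} {p m n i j : ℕ} [Fact p.Prime]
  [CharP F p]

namespace IsStructureConstants

theorem apply_eq_zero_of_le_add (h : IsStructureConstants S ν) (hS : ∀ u ∈ S, p ∣ u) (hn : 1 ≤ n)
    (hm : 1 ≤ m) (hi : i < p) (hj : j < p) (hni : p ∣ n + i) (hmj : p ∣ m + j) (hij : p ≤ i + j) :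
    ν n m = 0 := by
  obtain ⟨d, hd⟩ := Nat.exists_eq_add_of_le hij
  induction d generalizing n m i j with
  | zero =>
    refine h.apply_eq_zero_of_dvd_add hS hn hm (fun hpn => ?_) ?_
    · exact Nat.not_dvd_of_pos_of_lt (by omega) hi ((Nat.dvd_add_right hpn).1 hni)
    · have := dvd_add hni hmj
      rw [show n + i + (m + j) = n + m + p by omega] at this
      exact (Nat.dvd_add_left dvd_rfl).1 this
  | succ d ih =>
    have right : ν n (m + 1) = 0 := ih (i := i) (j := j - 1) hn (by omega) hi (by omega) hni
      (by rwa [show m + 1 + (j - 1) = m + j by omega]) (by omega) (by omega)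
    have left : ν (n + 1) m = 0 := ih (i := i - 1) (j := j) (by omega) hm (by omega) hj
      (by rwa [show n + 1 + (i - 1) = n + i by omega]) hmj (by omega) (by omega)
    linear_combination -(h.apply_succ hn hm) + right + left

theorem apply_add_eq_of_dvd (h : IsStructureConstants S ν) (hS : ∀ u ∈ S, p ∣ u) (hn : 1 ≤ n)
    (hm : 1 ≤ m) (hj : j < p) (hpn : p ∣ n) (hmj : p ∣ m + j) : ν n (m + j) = ν n m := by
  induction j generalizing m with
  | zero => rfl
  | succ j ih =>
    have shifted : ν (n + 1) m = 0 := h.apply_eq_zero_of_le_add hS (i := p - 1) (by omega) hm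
      (by omega) hj (by rw [show n + 1 + (p - 1) = n + p by omega]; exact dvd_add hpn dvd_rfl)
      hmj (by omega)
    have step := h.apply_succ hn hm
    rw [shifted, sub_zero] at step
    have hsucc : m + 1 + j = m + (j + 1) := by omega
    rw [← step, ← hsucc, ih (by omega) (by omega) (hsucc ▸ hmj)]

theorem apply_eq_choose_mul (h : IsStructureConstants S ν) (hS : ∀ u ∈ S, p ∣ u) (hn : 1 ≤ n)
    (hm : 1 ≤ m) (hij : i + j < p) (hni : p ∣ n + i) (hmj : p ∣ m + j) :
    ν n m = ((i + j).choose i : F) * ν (n + i) (m + j) := by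
  induction i generalizing n m j with
  | zero => simp [h.apply_add_eq_of_dvd hS hn hm (by omega) hni hmj]
  | succ i ih =>
    induction j generalizing m with
    | zero =>
      rw [add_zero, Nat.choose_self, Nat.cast_one, one_mul, add_zero, h.skew hn hm,
        h.skew (by omega) hm, h.apply_add_eq_of_dvd hS hm hn (by omega) hmj hni]
    | succ j ihj =>
      have right := ihj (m := m + 1) (by omega) (by omega) (by rwa [add_assoc, add_comm 1 j])
      have left := ih (n := n + 1) (m := m) (j := j + 1) (by omega) hm (by omega)
        (by rwa [add_assoc, add_comm 1 i]) hmj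
      rw [add_assoc m, add_comm 1 j] at right
      rw [add_assoc n, add_comm 1 i] at left
      rw [show i + 1 + (j + 1) = (i + (j + 1)) + 1 by ring, Nat.choose_succ_succ, Nat.cast_add]
      rw [show i + 1 + j = i + (j + 1) by ring] at right
      linear_combination -(h.apply_succ hn hm) + right + left

end IsStructureConstants

end InflationConstants

/-! ### Exceptional weights and constituents -/

section Exceptional

variable {F L : Type*} [Field F] [LieRing L] [LieAlgebra F L] {𝒢 : ℕ → Submodule F L}
  {i j l m n u : ℕ}

/-- The weights of the two-step centralizers that differ from the first one. Constituents end at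
these weights. -/
def exceptionalWeights (𝒢 : ℕ → Submodule F L) : Set ℕ :=
  {n | 2 ≤ n ∧ twoStep 𝒢 n ≠ twoStep 𝒢 2}

theorem two_lt_of_mem_exceptionalWeights (hn : n ∈ exceptionalWeights 𝒢) : 2 < n :=
  hn.1.lt_of_ne (by rintro rfl; exact hn.2 rfl)

theorem twoStep_eq_of_notMem_exceptionalWeights (hn : 2 ≤ n) (h : n ∉ exceptionalWeights 𝒢) :
    twoStep 𝒢 n = twoStep 𝒢 2 :=
  not_not.1 fun hne => h ⟨hn, hne⟩

theorem isLeast_firstLength (h : (exceptionalWeights 𝒢).Nonempty) :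
    IsLeast (exceptionalWeights 𝒢) (firstLength 𝒢) :=
  ⟨Nat.sInf_mem h, fun _ => Nat.sInf_le⟩

theorem isConstituent_zero_iff : IsConstituent 𝒢 0 m ↔ IsLeast (exceptionalWeights 𝒢) m := by
  constructor
  · rintro (⟨_, hm, hlast, hinner⟩ | ⟨_, _, h2, _⟩)
    · exact ⟨⟨hm, hlast⟩, fun j hj => not_lt.1 fun hlt => hj.2 (hinner j hj.1 hlt)⟩
    · omega
  · rintro ⟨hm, hleast⟩
    exact .first m hm.1 hm.2 fun j hj hjm =>
      twoStep_eq_of_notMem_exceptionalWeights hj fun h => hjm.not_ge (hleast h)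

theorem isConstituent_iff_gap (hi : i ≠ 0) :
    IsConstituent 𝒢 i m ↔ Gap (exceptionalWeights 𝒢) i m := by
  constructor
  · rintro (_ | ⟨_, _, h2, hm, hprev, hlast, hinner⟩)
    · exact absurd rfl hi
    · exact ⟨⟨h2, hprev⟩, hm, ⟨by omega, hlast⟩, fun j hj hjm hjS => hjS.2 (hinner j hj hjm)⟩
  · intro hg
    exact .later i m hg.start.1 hg.pos hg.start.2 hg.last.2 fun j hj hjm =>
      twoStep_eq_of_notMem_exceptionalWeights (hg.start.1.trans hj.le) (hg.inner j hj hjm)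

theorem IsConstituent.nonempty_exceptionalWeights (h : IsConstituent 𝒢 i m) :
    (exceptionalWeights 𝒢).Nonempty := by
  rcases eq_or_ne i 0 with rfl | hi
  · exact ⟨m, (isConstituent_zero_iff.1 h).1⟩
  · exact ⟨i, ((isConstituent_iff_gap hi).1 h).start⟩

theorem IsSecondNonShort.ne_zero (h : IsSecondNonShort 𝒢 i m) : i ≠ 0 := by
  rintro rfl
  simpa using h.2.2

theorem IsSecondNonShort.isShort_of_gap (h : IsSecondNonShort 𝒢 i m) (hui : u < i)
    (hg : Gap (exceptionalWeights 𝒢) u l) : IsShort 𝒢 l := by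
  by_contra hl
  have hfirst := isLeast_firstLength ⟨u, hg.start⟩
  have hu : u ≠ 0 := (pos_of_gt hg.start.1).ne'
  obtain ⟨z, hz⟩ := Set.ncard_eq_one.1 h.2.2
  have zero_eq : 0 = z := hz.subset ⟨pos_of_gt hui, _, isConstituent_zero_iff.2 hfirst, fun h =>
    by have := hfirst.1.1; rw [IsShort] at h; omega⟩
  have u_eq : u = z := hz.subset ⟨hui, l, (isConstituent_iff_gap hu).2 hg, hl⟩
  exact hu (u_eq.trans zero_eq.symm)

section Parameter

variable {p : ℕ} [Fact p.Prime] [CharP F p] {ν : ℕ → ℕ → F}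

theorem exists_firstLength_eq (hν : IsStructureConstants (exceptionalWeights 𝒢) ν) (hp2 : p ≠ 2)
    (hne : (exceptionalWeights 𝒢).Nonempty) : ∃ t, 1 ≤ t ∧ firstLength 𝒢 = 2 * p ^ t :=
  let ⟨t, ht, hn, _⟩ := hν.exists_parameter (isLeast_firstLength hne) hp2
  ⟨t, ht, hn⟩

theorem IsSecondNonShort.isShort_or_isLong_of_gap (h : IsSecondNonShort 𝒢 i m)
    (hlong : IsLong 𝒢 m) (hν : IsStructureConstants (exceptionalWeights 𝒢) ν) (hp2 : p ≠ 2)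
    (hg : Gap (exceptionalWeights 𝒢) u l) : IsShort 𝒢 l ∨ IsLong 𝒢 l := by
  have hne := h.1.nonempty_exceptionalWeights
  have hfirst := isLeast_firstLength hne
  have hgap := (isConstituent_iff_gap h.ne_zero).1 h.1
  obtain ⟨t, -, hn⟩ := exists_firstLength_eq hν hp2 hne
  rw [hlong, hn] at hgap
  rw [hn] at hfirst
  have hshort : ∀ w k, w < i → Gap (exceptionalWeights 𝒢) w k → k = p ^ t := fun w k hw hk => by
    have := h.isShort_of_gap hw hk
    rw [IsShort, hn] at this
    omega
  rw [IsShort, IsLong, hn]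
  have := hν.gap_short_or_long hp2 hfirst hgap hshort hg
  omega

theorem IsSecondNonShort.isShort_or_isLong (h : IsSecondNonShort 𝒢 i m) (hlong : IsLong 𝒢 m)
    (hν : IsStructureConstants (exceptionalWeights 𝒢) ν) (hp2 : p ≠ 2)
    (hc : IsConstituent 𝒢 u l) : IsShort 𝒢 l ∨ IsLong 𝒢 l := by
  rcases eq_or_ne u 0 with rfl | hu
  · exact .inr ((isConstituent_zero_iff.1 hc).unique
      (isLeast_firstLength h.1.nonempty_exceptionalWeights))
  · exact h.isShort_or_isLong_of_gap hlong hν hp2 ((isConstituent_iff_gap hu).1 hc)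

theorem IsSecondNonShort.dvd_of_mem_exceptionalWeights (h : IsSecondNonShort 𝒢 i m)
    (hlong : IsLong 𝒢 m) (hν : IsStructureConstants (exceptionalWeights 𝒢) ν) (hp2 : p ≠ 2) :
    ∀ u ∈ exceptionalWeights 𝒢, p ∣ u := by
  have hne := h.1.nonempty_exceptionalWeights
  obtain ⟨t, ht, hn⟩ := exists_firstLength_eq hν hp2 hne
  have hpt : p ∣ p ^ t := dvd_pow_self p (by omega)
  refine dvd_of_forall_gap_dvd (isLeast_firstLength hne) (hn ▸ hpt.mul_left 2) fun u l hg => ?_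
  rcases h.isShort_or_isLong_of_gap hlong hν hp2 hg with hl | hl
  · rw [IsShort, hn] at hl
    obtain rfl : l = p ^ t := by omega
    exact hpt
  · rw [hl, hn]
    exact hpt.mul_left 2

end Parameter

end Exceptional

/-! ### Adapted bases -/

section Adapted

variable {F L : Type*} [Field F] [LieRing L] [LieAlgebra F L]

theorem eq_top_of_lieSpan_eq_top {s : Set L} (hs : LieSubalgebra.lieSpan F L s = ⊤)
    {A : Submodule F L} (hsA : s ⊆ A) (hA : ∀ u ∈ s, ∀ w ∈ A, ⁅u, w⁆ ∈ A) : A = ⊤ := by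
  have stable : ∀ u : L, ∀ w ∈ A, ⁅u, w⁆ ∈ A := by
    intro u
    have hu : u ∈ LieSubalgebra.lieSpan F L s := hs ▸ LieSubalgebra.mem_top u
    induction hu using LieSubalgebra.lieSpan_induction with
    | mem u hu => exact hA u hu
    | zero => simp
    | add a b _ _ ha hb => intro w hw; rw [add_lie]; exact add_mem (ha w hw) (hb w hw)
    | smul c a _ ha => intro w hw; rw [smul_lie]; exact A.smul_mem c (ha w hw)
    | lie a b _ _ ha hb =>
      intro w hw
      rw [lie_lie]
      exact sub_mem (ha _ (hb w hw)) (hb _ (ha w hw))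
  refine eq_top_iff.2 fun u _ => ?_
  have hu : u ∈ LieSubalgebra.lieSpan F L s := hs ▸ LieSubalgebra.mem_top u
  exact (LieSubalgebra.lieSpan_le (K := ⟨A, fun _ hb => stable _ _ hb⟩)).2 hsA hu

theorem eq_span_singleton_of_rank_le_one {V : Type*} [AddCommGroup V] [Module F V]
    {W : Submodule F V} (hW : Module.rank F W ≤ 1) {w : V} (hw : w ∈ W) (hw0 : w ≠ 0) :
    W = Submodule.span F {w} := by
  have : FiniteDimensional F W := Module.rank_lt_aleph0_iff.1 (hW.trans_lt Cardinal.one_lt_aleph0)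
  refine (Submodule.eq_of_le_of_finrank_le ((Submodule.span_singleton_le_iff_mem w W).2 hw) ?_).symm
  rw [finrank_span_singleton hw0]
  exact Module.finrank_le_of_rank_le (by exact_mod_cast hW)

variable {𝒢 : ℕ → Submodule F L} [GradedLieAlgebra 𝒢] {m n : ℕ} {u w x y : L}

namespace IsMaximalClass

theorem fg_component (hL : IsMaximalClass 𝒢) (n : ℕ) : (𝒢 n).FG := by
  rw [← Module.Finite.iff_fg, ← Module.rank_lt_aleph0_iff]
  obtain rfl | rfl | hn : n = 0 ∨ n = 1 ∨ 2 ≤ n := by omega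
  · rw [hL.zero_eq_bot, rank_bot]
    exact Cardinal.aleph0_pos
  · rw [hL.rank_one]
    exact Cardinal.natCast_lt_aleph0 (n := 2)
  · exact (hL.rank_le_one n hn).trans_lt Cardinal.one_lt_aleph0

theorem exists_lie_ne_zero (hL : IsMaximalClass 𝒢) (hinf : ¬Module.Finite F L) (hn : 1 ≤ n) :
    ∃ u ∈ 𝒢 1, ∃ w ∈ 𝒢 n, ⁅u, w⁆ ≠ 0 := by
  by_contra! hzero
  let A : Submodule F L := ⨆ i ∈ Finset.range (n + 1), 𝒢 i
  have le_A : ∀ i ≤ n, 𝒢 i ≤ A := fun i hi =>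
    le_biSup (f := fun i => 𝒢 i) (Finset.mem_range_succ_iff.2 hi)
  have stable : ∀ u ∈ 𝒢 1, A ≤ A.comap (LieAlgebra.ad F L u) := by
    intro u hu
    refine iSup₂_le fun i hi w hw => ?_
    rcases (Finset.mem_range_succ_iff.1 hi).eq_or_lt with rfl | hlt
    · simp [hzero u hu w hw]
    · exact le_A (1 + i) (by omega) (SetLike.GradedBracket.bracket_mem hu hw)
  have hA : A = ⊤ := eq_top_of_lieSpan_eq_top hL.generated (le_A 1 hn) stable
  have fg_A : A.FG := Submodule.fg_biSup _ _ fun i _ => hL.fg_component i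
  exact hinf (Module.finite_def.2 (hA ▸ fg_A))

theorem component_eq_span (hL : IsMaximalClass 𝒢) (hn : 2 ≤ n) (hw : w ∈ 𝒢 n) (hw0 : w ≠ 0) :
    𝒢 n = Submodule.span F {w} :=
  eq_span_singleton_of_rank_le_one (hL.rank_le_one n hn) hw hw0

theorem mem_twoStep_iff (hL : IsMaximalClass 𝒢) (hn : 2 ≤ n) (hw : w ∈ 𝒢 n) (hw0 : w ≠ 0) :
    u ∈ twoStep 𝒢 n ↔ u ∈ 𝒢 1 ∧ ⁅w, u⁆ = 0 := by
  rw [← lie_skew, neg_eq_zero]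
  refine and_congr_right fun _ => ⟨fun h => h w hw, fun h v hv => ?_⟩
  rw [hL.component_eq_span hn hw hw0] at hv
  obtain ⟨c, rfl⟩ := Submodule.mem_span_singleton.1 hv
  rw [lie_smul, h, smul_zero]

theorem rank_twoStep (hL : IsMaximalClass 𝒢) (hinf : ¬Module.Finite F L) (hn : 2 ≤ n) :
    Module.rank F (twoStep 𝒢 n) = 1 := by
  obtain ⟨u, hu, w, hw, huw⟩ := hL.exists_lie_ne_zero hinf (one_le_two.trans hn)
  have hwu : ⁅w, u⁆ ≠ 0 := by rwa [← lie_skew, neg_ne_zero]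
  let φ : 𝒢 1 →ₗ[F] L := (LieAlgebra.ad F L w).domRestrict (𝒢 1)
  have range_eq : LinearMap.range φ = Submodule.span F {⁅w, u⁆} := by
    refine le_antisymm ?_ ((Submodule.span_singleton_le_iff_mem _ _).2 ⟨⟨u, hu⟩, rfl⟩)
    rintro _ ⟨a, rfl⟩
    rw [← hL.component_eq_span (n := n + 1) (by omega)
      (SetLike.GradedBracket.bracket_mem hw hu) hwu]
    exact SetLike.GradedBracket.bracket_mem hw a.2
  have twoStep_eq : twoStep 𝒢 n = (LinearMap.ker φ).map (𝒢 1).subtype := by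
    ext a
    rw [hL.mem_twoStep_iff hn hw (by rintro rfl; exact huw (lie_zero u))]
    exact ⟨fun ⟨ha, h⟩ => ⟨⟨a, ha⟩, h, rfl⟩, fun ⟨b, hb, hba⟩ => hba ▸ ⟨b.2, hb⟩⟩
  have : Module.Finite F (𝒢 1) := Module.Finite.iff_fg.2 (hL.fg_component 1)
  have rank_nullity := LinearMap.finrank_range_add_finrank_ker φ
  rw [range_eq, finrank_span_singleton hwu,
    Module.finrank_eq_of_rank_eq (n := 2) hL.rank_one] at rank_nullity
  rw [Module.rank_eq_one_iff_finrank_eq_one, twoStep_eq, Submodule.finrank_map_subtype_eq]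
  omega

theorem exists_ne_zero_mem_twoStep (hL : IsMaximalClass 𝒢) (hinf : ¬Module.Finite F L)
    (hn : 2 ≤ n) : ∃ u ∈ twoStep 𝒢 n, u ≠ 0 :=
  exists_mem_ne_zero_of_rank_pos (by rw [hL.rank_twoStep hinf hn]; exact one_pos)

theorem twoStep_eq_of_mem (hL : IsMaximalClass 𝒢) (hinf : ¬Module.Finite F L) (hm : 2 ≤ m)
    (hn : 2 ≤ n) (hu : u ∈ twoStep 𝒢 m) (hu' : u ∈ twoStep 𝒢 n) (hu0 : u ≠ 0) :
    twoStep 𝒢 m = twoStep 𝒢 n := by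
  rw [eq_span_singleton_of_rank_le_one (hL.rank_twoStep hinf hm).le hu hu0,
    eq_span_singleton_of_rank_le_one (hL.rank_twoStep hinf hn).le hu' hu0]

theorem component_one_eq_span (hL : IsMaximalClass 𝒢) (hx : x ∈ 𝒢 1) (hy : y ∈ 𝒢 1)
    (hxy : LinearIndependent F ![x, y]) : 𝒢 1 = Submodule.span F {x, y} := by
  have : Module.Finite F (𝒢 1) := Module.Finite.iff_fg.2 (hL.fg_component 1)
  refine (Submodule.eq_of_le_of_finrank_eq (Submodule.span_le.2 ?_) ?_).symm
  · rintro a (rfl | rfl) <;> assumption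
  · rw [Module.finrank_eq_of_rank_eq (n := 2) hL.rank_one, ← Matrix.range_cons_cons_empty x y ![]]
    exact finrank_span_eq_card hxy

theorem lie_ne_zero_of_linearIndependent (hL : IsMaximalClass 𝒢) (hinf : ¬Module.Finite F L)
    (hx : x ∈ 𝒢 1) (hy : y ∈ 𝒢 1) (hxy : LinearIndependent F ![x, y]) : ⁅y, x⁆ ≠ 0 := by
  intro hzero
  have hzero' : ⁅x, y⁆ = 0 := by rw [← lie_skew, hzero, neg_zero]
  obtain ⟨u, hu, w, hw, huw⟩ := hL.exists_lie_ne_zero hinf le_rfl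
  rw [hL.component_one_eq_span hx hy hxy, Submodule.mem_span_pair] at hu hw
  obtain ⟨a, b, rfl⟩ := hu
  obtain ⟨c, d, rfl⟩ := hw
  simp [hzero, hzero'] at huw

end IsMaximalClass

omit [GradedLieAlgebra 𝒢] in
theorem exists_forall_exceptionalWeights_twoStep_eq (htwo : (twoStepSet 𝒢).ncard = 2) :
    ∃ n ∈ exceptionalWeights 𝒢, ∀ i ∈ exceptionalWeights 𝒢, twoStep 𝒢 i = twoStep 𝒢 n := by
  have mem : ∀ i, 2 ≤ i → twoStep 𝒢 i ∈ twoStepSet 𝒢 := fun i hi => ⟨i, hi, rfl⟩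
  have card : (twoStepSet 𝒢 \ {twoStep 𝒢 2}).ncard = 1 := by
    rw [Set.ncard_sdiff_singleton_of_mem (mem 2 le_rfl), htwo]
  obtain ⟨C, hC⟩ := Set.ncard_eq_one.1 card
  have exceptional : ∀ i ∈ exceptionalWeights 𝒢, twoStep 𝒢 i = C :=
    fun i hi => hC.subset ⟨mem i hi.1, hi.2⟩
  obtain ⟨⟨n, hn, rfl⟩, hne⟩ := hC.superset rfl
  exact ⟨n, ⟨hn, hne⟩, exceptional⟩

omit [GradedLieAlgebra 𝒢] in
theorem add_notMem_twoStep (hall : ∀ i ∈ exceptionalWeights 𝒢, twoStep 𝒢 i = twoStep 𝒢 n)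
    (hx : x ∈ twoStep 𝒢 n) (hx2 : x ∉ twoStep 𝒢 2) (hy : y ∈ twoStep 𝒢 2) (hyn : y ∉ twoStep 𝒢 n)
    (hm : 2 ≤ m) : x + y ∉ twoStep 𝒢 m := by
  intro h
  by_cases hmS : m ∈ exceptionalWeights 𝒢
  · rw [hall m hmS] at h
    exact hyn (((twoStep 𝒢 n).add_mem_iff_right hx).1 h)
  · rw [twoStep_eq_of_notMem_exceptionalWeights hm hmS] at h
    exact hx2 (((twoStep 𝒢 2).add_mem_iff_left hy).1 h)

omit [GradedLieAlgebra 𝒢] in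
theorem lie_eq_indicator_smul_lie_add (hx : ∀ i ∈ exceptionalWeights 𝒢, x ∈ twoStep 𝒢 i)
    (hy : y ∈ twoStep 𝒢 2) (hn : 2 ≤ n) (hw : w ∈ 𝒢 n) :
    ⁅w, y⁆ = (exceptionalWeights 𝒢).indicator (1 : ℕ → F) n • ⁅w, x + y⁆ := by
  by_cases hnS : n ∈ exceptionalWeights 𝒢
  · have lie_x : ⁅w, x⁆ = 0 := by rw [← lie_skew, (hx n hnS).2 w hw, neg_zero]
    simp [hnS, lie_x]
  · rw [← twoStep_eq_of_notMem_exceptionalWeights hn hnS] at hy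
    simp [hnS, ← lie_skew w y, hy.2 w hw]

/-- A basis `x, v 1, v 2, …` of an algebra of maximal class with two distinct two-step centralizers,
spanned by `v 1` and `x`. -/
structure IsAdapted (𝒢 : ℕ → Submodule F L) (x : L) (v : ℕ → L) : Prop where
  x_mem : x ∈ 𝒢 1
  mem : ∀ {n}, 1 ≤ n → v n ∈ 𝒢 n
  ne_zero : ∀ {n}, 1 ≤ n → v n ≠ 0
  linearIndependent : LinearIndependent F ![x, v 1]
  component_one : 𝒢 1 = Submodule.span F {x, v 1}
  component : ∀ {n}, 2 ≤ n → 𝒢 n = Submodule.span F {v n}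
  lie_x_add : ∀ {n}, 1 ≤ n → ⁅v n, x + v 1⁆ = v (n + 1)
  lie_one : ∀ {n}, 1 ≤ n → ⁅v n, v 1⁆ = (exceptionalWeights 𝒢).indicator (1 : ℕ → F) n • v (n + 1)

namespace IsMaximalClass

theorem iterate_lie_mem_and_ne_zero (hL : IsMaximalClass 𝒢) (hy : y ∈ 𝒢 1) (hw : w ∈ 𝒢 1)
    (hyw : ⁅y, w⁆ ≠ 0) (hw' : ∀ i, 2 ≤ i → w ∉ twoStep 𝒢 i) (k : ℕ) :
    (⁅·, w⁆)^[k] y ∈ 𝒢 (k + 1) ∧ (⁅·, w⁆)^[k] y ≠ 0 := by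
  induction k with
  | zero => exact ⟨hy, fun h => hyw (by rw [show y = 0 from h, zero_lie])⟩
  | succ k ih =>
    rw [Function.iterate_succ_apply']
    refine ⟨SetLike.GradedBracket.bracket_mem ih.1 hw, fun hzero => ?_⟩
    rcases k.eq_zero_or_pos with rfl | hk
    · exact hyw hzero
    · exact hw' (k + 1) (by omega) ((hL.mem_twoStep_iff (by omega) ih.1 ih.2).2 ⟨hw, hzero⟩)

theorem isAdapted_iterate_lie (hL : IsMaximalClass 𝒢) (hinf : ¬Module.Finite F L)
    (hn : n ∈ exceptionalWeights 𝒢)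
    (hall : ∀ i ∈ exceptionalWeights 𝒢, twoStep 𝒢 i = twoStep 𝒢 n)
    (hx : x ∈ twoStep 𝒢 n) (hx0 : x ≠ 0) (hy : y ∈ twoStep 𝒢 2) (hy0 : y ≠ 0) :
    IsAdapted 𝒢 x fun i => (⁅·, x + y⁆)^[i - 1] y := by
  have x_notMem : x ∉ twoStep 𝒢 2 := fun h => hn.2 (hL.twoStep_eq_of_mem hinf hn.1 le_rfl hx h hx0)
  have y_notMem : y ∉ twoStep 𝒢 n := fun h => hn.2 (hL.twoStep_eq_of_mem hinf hn.1 le_rfl h hy hy0)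
  have hxy : LinearIndependent F ![x, y] := (LinearIndependent.pair_iff' hx0).2 fun a ha =>
    y_notMem (ha ▸ Submodule.smul_mem _ a hx)
  have add_notMem := fun i (hi : 2 ≤ i) =>
    add_notMem_twoStep hall hx x_notMem hy y_notMem hi
  have lie_ne_zero : ⁅y, x + y⁆ ≠ 0 := by
    rw [lie_add, lie_self, add_zero]
    exact hL.lie_ne_zero_of_linearIndependent hinf hx.1 hy.1 hxy
  have basis := hL.iterate_lie_mem_and_ne_zero hy.1 (add_mem hx.1 hy.1) lie_ne_zero add_notMem
  have mem : ∀ {i}, 1 ≤ i → (⁅·, x + y⁆)^[i - 1] y ∈ 𝒢 i := fun {i} hi => by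
    simpa [hi] using (basis (i - 1)).1
  have lie_add : ∀ {i}, 1 ≤ i → ⁅(⁅·, x + y⁆)^[i - 1] y, x + y⁆ = (⁅·, x + y⁆)^[i] y :=
    fun {i} hi => by rw [← Function.iterate_succ_apply' (⁅·, x + y⁆), Nat.succ_eq_add_one,
      Nat.sub_add_cancel hi]
  have ne_zero := fun i => (basis i).2
  refine ⟨hx.1, mem, fun _ => ne_zero _, hxy, hL.component_one_eq_span hx.1 hy.1 hxy,
    fun hi => hL.component_eq_span hi (mem (one_le_two.trans hi)) (ne_zero _), lie_add,
    fun {i} hi => ?_⟩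
  rw [Nat.add_sub_cancel, ← lie_add hi]
  rcases hi.eq_or_lt with rfl | hi2
  · have : 1 ∉ exceptionalWeights 𝒢 := fun h => absurd h.1 (by norm_num)
    simp [this]
  · exact lie_eq_indicator_smul_lie_add (fun j hj => hall j hj ▸ hx) hy hi2 (mem hi)

theorem exists_isAdapted (hL : IsMaximalClass 𝒢) (hinf : ¬Module.Finite F L)
    (htwo : (twoStepSet 𝒢).ncard = 2) : ∃ x v, IsAdapted 𝒢 x v := by
  obtain ⟨n, hn, hall⟩ := exists_forall_exceptionalWeights_twoStep_eq htwo
  obtain ⟨x, hx, hx0⟩ := hL.exists_ne_zero_mem_twoStep hinf hn.1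
  obtain ⟨y, hy, hy0⟩ := hL.exists_ne_zero_mem_twoStep hinf le_rfl
  exact ⟨x, _, hL.isAdapted_iterate_lie hinf hn hall hx hx0 hy hy0⟩

end IsMaximalClass

namespace IsAdapted

variable {v : ℕ → L} {ν : ℕ → ℕ → F} {i j : ℕ}

omit [GradedLieAlgebra 𝒢] in
theorem smul_left_injective (h : IsAdapted 𝒢 x v) (hn : 1 ≤ n) :
    Function.Injective fun a : F => a • v n :=
  _root_.smul_left_injective F (h.ne_zero hn)

theorem exists_forall_lie_eq (h : IsAdapted 𝒢 x v) :
    ∃ ν : ℕ → ℕ → F, ∀ {i j}, 1 ≤ i → 1 ≤ j → ⁅v i, v j⁆ = ν i j • v (i + j) := by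
  have exists_coeff : ∀ i j, ∃ c : F, 1 ≤ i → 1 ≤ j → ⁅v i, v j⁆ = c • v (i + j) := by
    intro i j
    by_cases hij : 1 ≤ i ∧ 1 ≤ j
    · have mem : ⁅v i, v j⁆ ∈ 𝒢 (i + j) :=
        SetLike.GradedBracket.bracket_mem (h.mem hij.1) (h.mem hij.2)
      rw [h.component (by omega)] at mem
      obtain ⟨c, hc⟩ := Submodule.mem_span_singleton.1 mem
      exact ⟨c, fun _ _ => hc.symm⟩
    · exact ⟨0, fun hi hj => absurd ⟨hi, hj⟩ hij⟩
  choose ν hν using exists_coeff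
  exact ⟨ν, fun {i j} => hν i j⟩

omit [GradedLieAlgebra 𝒢] in
theorem isStructureConstants (h : IsAdapted 𝒢 x v)
    (hν : ∀ {i j}, 1 ≤ i → 1 ≤ j → ⁅v i, v j⁆ = ν i j • v (i + j)) :
    IsStructureConstants (exceptionalWeights 𝒢) ν where
  apply_succ {i j} hi hj := by
    refine h.smul_left_injective (n := i + j + 1) (by omega) ?_
    have jacobi := lie_lie (v i) (v j) (x + v 1)
    rw [← lie_skew (v j) ⁅v i, x + v 1⁆, hν hi hj, smul_lie, h.lie_x_add hi, h.lie_x_add hj,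
      h.lie_x_add (by omega), hν hi (by omega), hν (by omega) hj, ← add_assoc,
      add_right_comm i 1 j] at jacobi
    simp only [sub_smul, jacobi]
    abel
  skew {i j} hi hj := by
    refine h.smul_left_injective (n := i + j) (by omega) ?_
    simp only [neg_smul]
    rw [← hν hi hj, add_comm, ← hν hj hi, lie_skew]
  two_lt := two_lt_of_mem_exceptionalWeights
  apply_one {i} hi := h.smul_left_injective (n := i + 1) (by omega)
    ((hν hi le_rfl).symm.trans (h.lie_one hi))
  leibniz {i j} hi hj := by
    refine h.smul_left_injective (n := i + j + 1) (by omega) ?_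
    have jacobi := lie_lie (v i) (v j) (v 1)
    rw [← lie_skew (v j) ⁅v i, v 1⁆, hν hi hj, smul_lie, h.lie_one hi, h.lie_one hj,
      h.lie_one (by omega), smul_lie, lie_smul, hν hi (by omega), hν (by omega) hj, ← add_assoc,
      add_right_comm i 1 j, smul_smul, smul_smul, smul_smul] at jacobi
    simp only [add_smul, mul_comm _ (ν i j), jacobi]
    abel

end IsAdapted

end Adapted

/-! ### Divided powers in `F[ε]/(ε^p)` and inflations -/

section DividedPower

variable {F : Type*} [Field F] {p : ℕ} {i j : ℕ}

theorem eps_pow_of_le (h : p ≤ i) : eps F p ^ i = 0 := by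
  have eps_pow_self := AdjoinRoot.mk_self (f := (Polynomial.X ^ p : F[X]))
  rw [map_pow, AdjoinRoot.mk_X] at eps_pow_self
  exact pow_eq_zero_of_le h eps_pow_self

theorem truncDer_mk [CharP F p] (f : F[X]) :
    truncDer F p (AdjoinRoot.mk _ f) = AdjoinRoot.mk _ (Polynomial.derivative f) := by
  rw [truncDer]
  exact Derivation.liftOfSurjective_apply (f := AdjoinRoot.mkₐ (Polynomial.X ^ p : F[X]))
    AdjoinRoot.mk_surjective _ f

theorem truncDer_eps_pow [CharP F p] (i : ℕ) :
    truncDer F p (eps F p ^ i) = (i : F) • eps F p ^ (i - 1) := by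
  have truncDer_eps : truncDer F p (eps F p) = 1 := by
    simpa [eps] using truncDer_mk (F := F) (p := p) Polynomial.X
  rw [Derivation.leibniz_pow, truncDer_eps, smul_eq_mul, mul_one, Nat.cast_smul_eq_nsmul]

theorem cast_factorial_ne_zero [Fact p.Prime] [CharP F p] (hi : i < p) :
    (i.factorial : F) ≠ 0 := by
  rw [Ne, CharP.cast_eq_zero_iff F p, (Fact.out : p.Prime).dvd_factorial]
  omega

theorem cast_factorial_pred [Fact p.Prime] [CharP F p] : ((p - 1).factorial : F) = -1 := by
  have wilson := congrArg (ZMod.castHom (dvd_refl p) F) (ZMod.wilsons_lemma p)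
  rwa [map_natCast, map_neg, map_one] at wilson

/-- The divided power `(-ε)^i / i!` in `F[ε]/(ε^p)`. In characteristic `p` it is meant for
`i < p`: for larger `i` the factorial vanishes, and so does `ε^i`. -/
def dividedPower (F : Type*) [Field F] (p i : ℕ) : Trunc F p :=
  ((-1) ^ i * (i.factorial : F)⁻¹) • eps F p ^ i

theorem dividedPower_zero : dividedPower F p 0 = 1 := by
  simp [dividedPower]

theorem isUnit_dividedPower_coeff [Fact p.Prime] [CharP F p] (hi : i < p) :
    IsUnit ((-1) ^ i * (i.factorial : F)⁻¹) :=
  IsUnit.mk0 _ (mul_ne_zero (pow_ne_zero _ (neg_ne_zero.2 one_ne_zero))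
    (inv_ne_zero (cast_factorial_ne_zero hi)))

theorem dividedPower_mul_of_lt [Fact p.Prime] [CharP F p] (hij : i + j < p) :
    dividedPower F p i * dividedPower F p j =
      ((i + j).choose i : F) • dividedPower F p (i + j) := by
  have choose_mul : ((i + j).choose i : F) * i.factorial * j.factorial = (i + j).factorial := by
    rw [Nat.choose_symm_add]
    exact_mod_cast congrArg (Nat.cast (R := F)) (Nat.add_choose_mul_factorial_mul_factorial i j)
  have hi : (i.factorial : F) ≠ 0 := cast_factorial_ne_zero (p := p) (by omega)
  have hj : (j.factorial : F) ≠ 0 := cast_factorial_ne_zero (p := p) (by omega)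
  have hsum : ((i + j).factorial : F) ≠ 0 := cast_factorial_ne_zero hij
  rw [dividedPower, dividedPower, dividedPower, smul_mul_smul_comm, ← pow_add, smul_smul]
  congr 1
  field_simp
  linear_combination -(-1) ^ (i + j) * choose_mul

theorem dividedPower_mul_of_le (hij : p ≤ i + j) :
    dividedPower F p i * dividedPower F p j = 0 := by
  rw [dividedPower, dividedPower, smul_mul_smul_comm, ← pow_add, eps_pow_of_le hij, smul_zero]

theorem truncDer_dividedPower_zero [CharP F p] : truncDer F p (dividedPower F p 0) = 0 := by
  rw [dividedPower_zero, Derivation.map_one_eq_zero]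

theorem truncDer_dividedPower_succ [Fact p.Prime] [CharP F p] (hi : i + 1 < p) :
    truncDer F p (dividedPower F p (i + 1)) = -dividedPower F p i := by
  have succ_ne_zero : ((i + 1 : ℕ) : F) ≠ 0 := by
    have := cast_factorial_ne_zero (F := F) hi
    rw [Nat.factorial_succ, Nat.cast_mul] at this
    exact left_ne_zero_of_mul this
  rw [dividedPower, dividedPower, Derivation.map_smul, truncDer_eps_pow, Nat.add_sub_cancel,
    smul_smul, Nat.factorial_succ, Nat.cast_mul, ← neg_smul]
  congr 1
  field_simp
  ring

theorem eps_pow_pred [Fact p.Prime] [CharP F p] (hp2 : p ≠ 2) :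
    eps F p ^ (p - 1) = -dividedPower F p (p - 1) := by
  rw [dividedPower, cast_factorial_pred, ((Fact.out : p.Prime).even_sub_one hp2).neg_one_pow,
    one_mul, inv_neg, inv_one, neg_one_smul, neg_neg]

theorem eps_pow_pred_mul_dividedPower_succ :
    eps F p ^ (p - 1) * dividedPower F p (i + 1) = 0 := by
  rw [dividedPower, mul_smul_comm, ← pow_add, eps_pow_of_le (by omega), smul_zero]

/-- The basis of `F[ε]/(ε^p)` which consists of the divided powers `(-ε)^i / i!`, `i < p`. -/
def dividedPowerBasis (F : Type*) [Field F] (p : ℕ) [Fact p.Prime] [CharP F p] :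
    Module.Basis (Fin p) F (Trunc F p) :=
  ((AdjoinRoot.powerBasis' (Polynomial.monic_X_pow (R := F) p)).basis.reindex
    (finCongr (by simp))).isUnitSMul fun i => isUnit_dividedPower_coeff i.2

theorem dividedPowerBasis_apply [Fact p.Prime] [CharP F p] (i : Fin p) :
    dividedPowerBasis F p i = dividedPower F p i := by
  rw [dividedPowerBasis, Module.Basis.isUnitSMul_apply, Module.Basis.reindex_apply,
    PowerBasis.basis_eq_pow]
  rfl

end DividedPower

section InflationBasis

variable {F N : Type*} [Field F] [LieRing N] [LieAlgebra F N]
variable {p : ℕ} [Fact p.Prime] {i n : ℕ}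

/-- The weight `p (j + 1) - i` of `ε^i ⊗ u` in an inflation, for `u` of weight `j + 1`. -/
def inflationWeight (p : ℕ) (a : Fin p × ℕ) : ℕ :=
  p * (a.2 + 1) - a.1

omit [Fact p.Prime] in
theorem inflationWeight_add (a : Fin p × ℕ) : inflationWeight p a + a.1 = p * (a.2 + 1) :=
  Nat.sub_add_cancel (a.1.2.le.trans (Nat.le_mul_of_pos_right p a.2.succ_pos))

omit [Fact p.Prime] in
theorem one_le_inflationWeight (a : Fin p × ℕ) : 1 ≤ inflationWeight p a := by
  have := a.1.2
  have := inflationWeight_add a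
  rw [mul_add, mul_one] at this
  omega

omit [Fact p.Prime] in
theorem inflationWeight_injective : Function.Injective (inflationWeight p) := by
  rintro ⟨i, j⟩ ⟨k, l⟩ hweight
  have hij := inflationWeight_add (i, j)
  have hkl := inflationWeight_add (k, l)
  rw [hweight] at hij
  have hjl : j = l := by
    by_contra hne
    rcases Nat.lt_or_gt_of_ne hne with hlt | hlt
    · nlinarith [i.2, k.2, Nat.mul_le_mul_left p hlt]
    · nlinarith [i.2, k.2, Nat.mul_le_mul_left p hlt]
  subst hjl
  exact Prod.ext (Fin.ext (Nat.add_left_cancel (hij.trans hkl.symm))) rfl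

theorem exists_inflationWeight_eq (p : ℕ) [Fact p.Prime] (hn : 1 ≤ n) :
    ∃ a : Fin p × ℕ, inflationWeight p a = n := by
  have hmod := Nat.mod_lt (n - 1) (Fact.out : p.Prime).pos
  have hdiv := Nat.div_add_mod (n - 1) p
  refine ⟨(⟨p - 1 - (n - 1) % p, by omega⟩, (n - 1) / p), ?_⟩
  rw [inflationWeight, mul_add, mul_one]
  dsimp only
  omega

theorem range_inflationWeight : Set.range (inflationWeight p) = Set.Ici 1 :=
  Set.Subset.antisymm (Set.range_subset_iff.2 one_le_inflationWeight)
    fun _ hn => exists_inflationWeight_eq p hn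

variable [CharP F p] {I : LieIdeal F N}

/-- The basis of an inflation which consists of the derivation and the elements
`(-ε)^i / i! ⊗ b j`. -/
def inflationBasis (b : Module.Basis ℕ F I) (s : N) :
    Module.Basis (Option (Fin p × ℕ)) F (Inflation p I s) :=
  ((((dividedPowerBasis F p).tensorProduct b).prod (Module.Basis.singleton PUnit.{1} F)).map
    (LieAlgebra.SemiDirectSum.toProdl (derHom (inflationDer p I s))).symm).reindex
    (Equiv.optionEquivSumPUnit.{0} _).symm

theorem inflationBasis_none (b : Module.Basis ℕ F I) (s : N) :
    inflationBasis (p := p) b s none = ⟨0, 1⟩ := by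
  simp only [inflationBasis, Module.Basis.reindex_apply, Equiv.symm_symm,
    Equiv.optionEquivSumPUnit_none, Module.Basis.map_apply, Module.Basis.prod_apply, Sum.elim_inr,
    Function.comp_apply, Module.Basis.singleton_apply]
  rfl

theorem inflationBasis_some (b : Module.Basis ℕ F I) (s : N) (a : Fin p × ℕ) :
    inflationBasis (p := p) b s (some a) = ⟨dividedPower F p a.1 ⊗ₜ b a.2, 0⟩ := by
  simp only [inflationBasis, Module.Basis.reindex_apply, Equiv.symm_symm,
    Equiv.optionEquivSumPUnit_some, Module.Basis.map_apply, Module.Basis.prod_apply, Sum.elim_inl,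
    Function.comp_apply, Module.Basis.tensorProduct_apply', dividedPowerBasis_apply]
  rfl

omit [Fact p.Prime] in
theorem inflationDer_tmul (s : N) (a : Trunc F p) (u : I) :
    inflationDer p I s (a ⊗ₜ[F] u) =
      truncDer F p a ⊗ₜ[F] u + (eps F p ^ (p - 1) * a) ⊗ₜ[F] idealDer I s u :=
  rfl

theorem inflationDer_dividedPower_zero_tmul (hp2 : p ≠ 2) (s : N) (u : I) :
    inflationDer p I s (dividedPower F p 0 ⊗ₜ u) =
      -(dividedPower F p (p - 1) ⊗ₜ[F] idealDer I s u) := by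
  rw [inflationDer_tmul, truncDer_dividedPower_zero, dividedPower_zero, mul_one, eps_pow_pred hp2,
    TensorProduct.zero_tmul, zero_add, TensorProduct.neg_tmul]

theorem inflationDer_dividedPower_succ_tmul (hi : i + 1 < p) (s : N) (u : I) :
    inflationDer p I s (dividedPower F p (i + 1) ⊗ₜ u) = -(dividedPower F p i ⊗ₜ[F] u) := by
  rw [inflationDer_tmul, truncDer_dividedPower_succ hi, eps_pow_pred_mul_dividedPower_succ,
    TensorProduct.zero_tmul, add_zero, TensorProduct.neg_tmul]

end InflationBasis

section Extension

variable {F K : Type*} [Field F] [LieRing K] [LieAlgebra F K] (D : LieDerivation F K K)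

theorem derExt_lie_mk_zero (a b : K) :
    ⁅(⟨a, 0⟩ : DerExt D), (⟨b, 0⟩ : DerExt D)⁆ = ⟨⁅a, b⁆, 0⟩ := by
  simp

theorem derExt_lie_mk_right (a : K) (c : F) :
    ⁅(⟨a, 0⟩ : DerExt D), (⟨0, c⟩ : DerExt D)⁆ = ⟨-(c • D a), 0⟩ := by
  have derHom_apply : derHom D c a = c • D a := rfl
  rw [LieAlgebra.SemiDirectSum.lie_eq_mk, derHom_apply]
  simp

end Extension

section InflationEquiv

variable {F L : Type*} [Field F] [LieRing L] [LieAlgebra F L]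
variable {𝒢 : ℕ → Submodule F L} [GradedLieAlgebra 𝒢] {x : L} {v : ℕ → L}

theorem iSup_component : ⨆ n, 𝒢 n = ⊤ :=
  (DirectSum.Decomposition.isInternal 𝒢).submodule_iSup_eq_top

namespace IsAdapted

variable {ι : Type*} {f : ι → ℕ} {n : ℕ}

theorem linearIndependent_comp (h : IsAdapted 𝒢 x v) (hf : Function.Injective f)
    (hf1 : ∀ k, 1 ≤ f k) : LinearIndependent F fun k => v (f k) := by
  have independent : iSupIndep fun k => 𝒢 (f k) :=
    (DirectSum.Decomposition.isInternal 𝒢).submodule_iSupIndep.comp hf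
  exact independent.linearIndependent _ (fun k => h.mem (hf1 k)) fun k => h.ne_zero (hf1 k)

theorem notMem_span_range_comp (h : IsAdapted 𝒢 x v) (hf1 : ∀ k, 1 ≤ f k) :
    x ∉ Submodule.span F (Set.range fun k => v (f k)) := by
  intro hx
  let proj : L →ₗ[F] L := (𝒢 1).subtype ∘ₗ DirectSum.component F ℕ (fun i => 𝒢 i) 1 ∘ₗ
    (DirectSum.decomposeLinearEquiv 𝒢).toLinearMap
  have proj_of_mem : ∀ w ∈ 𝒢 1, proj w = w := fun w hw => DirectSum.decompose_of_mem_same 𝒢 hw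
  have span_le : Submodule.span F (Set.range fun k => v (f k)) ≤
      (Submodule.span F {v 1}).comap proj := by
    rw [Submodule.span_le]
    rintro _ ⟨k, rfl⟩
    change proj (v (f k)) ∈ Submodule.span F {v 1}
    rcases eq_or_ne (f k) 1 with hk | hk
    · rw [hk, proj_of_mem _ (h.mem le_rfl)]
      exact Submodule.mem_span_singleton_self _
    · have proj_eq_zero : proj (v (f k)) = 0 :=
        DirectSum.decompose_of_mem_ne 𝒢 (h.mem (hf1 k)) hk
      exact proj_eq_zero ▸ zero_mem _
  have x_mem_span : x ∈ Submodule.span F {v 1} := proj_of_mem x h.x_mem ▸ span_le hx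
  obtain ⟨c, hc⟩ := Submodule.mem_span_singleton.1 x_mem_span
  exact (LinearIndependent.pair_iff' (h.ne_zero le_rfl)).1
    (LinearIndependent.pair_symm_iff.1 h.linearIndependent) c hc

theorem span_eq_top (h : IsAdapted 𝒢 x v) (h0 : 𝒢 0 = ⊥) (hf : Set.range f = Set.Ici 1) :
    Submodule.span F (Set.range fun o : Option ι => o.casesOn' x fun k => v (f k)) = ⊤ := by
  set W := Submodule.span F (Set.range fun o : Option ι => o.casesOn' x fun k => v (f k))
  have x_mem : x ∈ W := Submodule.subset_span ⟨none, rfl⟩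
  have v_mem : ∀ n, 1 ≤ n → v n ∈ W := by
    intro n hn
    obtain ⟨k, rfl⟩ : n ∈ Set.range f := hf ▸ hn
    exact Submodule.subset_span ⟨some k, rfl⟩
  rw [eq_top_iff, ← iSup_component (𝒢 := 𝒢), iSup_le_iff]
  rintro (_ | _ | n)
  · exact h0 ▸ bot_le
  · rw [zero_add, h.component_one, Submodule.span_le]
    rintro a (rfl | rfl)
    exacts [x_mem, v_mem 1 le_rfl]
  · rw [h.component (by omega), Submodule.span_singleton_le_iff_mem]
    exact v_mem _ (by omega)

/-- The basis of `L` which consists of `x` and the `v n`, `n ≥ 1`, the latter reindexed by `f`. -/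
def basis (h : IsAdapted 𝒢 x v) (h0 : 𝒢 0 = ⊥) (hf : Function.Injective f)
    (hrange : Set.range f = Set.Ici 1) : Module.Basis (Option ι) F L :=
  have hf1 : ∀ k, 1 ≤ f k := fun k => hrange.le (Set.mem_range_self k)
  Module.Basis.mk (linearIndependent_option'.2
    ⟨h.linearIndependent_comp hf hf1, h.notMem_span_range_comp hf1⟩) (h.span_eq_top h0 hrange).ge

theorem basis_apply (h : IsAdapted 𝒢 x v) (h0 : 𝒢 0 = ⊥) (hf : Function.Injective f)
    (hrange : Set.range f = Set.Ici 1) (o : Option ι) :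
    h.basis h0 hf hrange o = o.casesOn' x fun k => v (f k) := by
  simp [basis]

omit [GradedLieAlgebra 𝒢] in
theorem lie_x (h : IsAdapted 𝒢 x v) (hn : 1 ≤ n) :
    ⁅v n, x⁆ = (exceptionalWeights 𝒢)ᶜ.indicator (1 : ℕ → F) n • v (n + 1) := by
  rw [Set.indicator_compl, Pi.sub_apply, sub_smul, ← h.lie_one hn, Pi.one_apply, one_smul,
    ← h.lie_x_add hn, lie_add, add_sub_cancel_right]

end IsAdapted

theorem map_lie_of_span_eq_top {L' : Type*} [LieRing L'] [LieAlgebra F L'] {A : Set L}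
    (hA : Submodule.span F A = ⊤) (f : L →ₗ[F] L')
    (hf : ∀ a ∈ A, ∀ b ∈ A, f ⁅a, b⁆ = ⁅f a, f b⁆) (a b : L) : f ⁅a, b⁆ = ⁅f a, f b⁆ := by
  have ha : a ∈ Submodule.span F A := hA ▸ Submodule.mem_top
  have hb : b ∈ Submodule.span F A := hA ▸ Submodule.mem_top
  induction ha, hb using Submodule.span_induction₂ with
  | mem_mem a b ha hb => exact hf a ha b hb
  | zero_left b _ => simp
  | zero_right a _ => simp
  | add_left a a' b _ _ _ h1 h2 => simp [h1, h2]
  | add_right a b b' _ _ _ h1 h2 => simp [h1, h2]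
  | smul_left c a b _ _ h1 => simp [h1]
  | smul_right c a b _ _ h1 => simp [h1]

end InflationEquiv

section InflationEquiv

variable {F N : Type*} [Field F] [LieRing N] [LieAlgebra F N]
variable {p : ℕ} {S : Set ℕ} {ν : ℕ → ℕ → F}
variable {I : LieIdeal F N} {b : Module.Basis ℕ F I} {s : N} {n : ℕ}

/-- The basis `b` of the ideal `I` multiplies like the elements `v p, v (2 p), …` of an algebra with
structure constants `ν`, and `s` acts on it like `-(ad x)^p`; the index `j` stands for the weight
`p (j + 1)`. -/
structure IsDeflationBasis (p : ℕ) (S : Set ℕ) (ν : ℕ → ℕ → F) (b : Module.Basis ℕ F I) (s : N) :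
    Prop where
  lie (i j : ℕ) : ⁅b i, b j⁆ = ν (p * (i + 1)) (p * (j + 1)) • b (i + j + 1)
  idealDer_apply (j : ℕ) :
    idealDer I s (b j) = Sᶜ.indicator (1 : ℕ → F) (p * (j + 1)) • b (j + 1)

variable [Fact p.Prime] [CharP F p]
variable {L : Type*} [LieRing L] [LieAlgebra F L] {𝒢 : ℕ → Submodule F L} [GradedLieAlgebra 𝒢]
variable {x : L} {v : ℕ → L}

namespace IsAdapted

/-- The linear isomorphism with an inflation which sends `x` to the derivation and `v n` to
`(-ε)^i / i! ⊗ b j`, where `n = p (j + 1) - i`. -/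
def toInflation (h : IsAdapted 𝒢 x v) (h0 : 𝒢 0 = ⊥) (b : Module.Basis ℕ F I) (s : N) :
    L ≃ₗ[F] Inflation p I s :=
  (h.basis h0 inflationWeight_injective range_inflationWeight).equiv (inflationBasis b s)
    (Equiv.refl _)

theorem toInflation_casesOn (h : IsAdapted 𝒢 x v) (h0 : 𝒢 0 = ⊥) (o : Option (Fin p × ℕ)) :
    h.toInflation h0 b s (o.casesOn' x fun a => v (inflationWeight p a)) =
      inflationBasis b s o := by
  rw [toInflation, ← h.basis_apply h0 inflationWeight_injective range_inflationWeight,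
    Module.Basis.equiv_apply, Equiv.refl_apply]

theorem toInflation_x (h : IsAdapted 𝒢 x v) (h0 : 𝒢 0 = ⊥) :
    h.toInflation (p := p) h0 b s x = ⟨0, 1⟩ :=
  (h.toInflation_casesOn h0 none).trans (inflationBasis_none b s)

theorem toInflation_apply (h : IsAdapted 𝒢 x v) (h0 : 𝒢 0 = ⊥) {i j : ℕ} (hi : i < p)
    (hn : n + i = p * (j + 1)) :
    h.toInflation h0 b s (v n) = ⟨dividedPower F p i ⊗ₜ b j, 0⟩ := by
  obtain rfl : inflationWeight p (⟨i, hi⟩, j) = n :=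
    Nat.add_right_cancel ((inflationWeight_add _).trans hn.symm)
  exact (h.toInflation_casesOn h0 (some _)).trans (inflationBasis_some b s _)

theorem toInflation_lie (h : IsAdapted 𝒢 x v) (h0 : 𝒢 0 = ⊥)
    (hν : ∀ {i j}, 1 ≤ i → 1 ≤ j → ⁅v i, v j⁆ = ν i j • v (i + j))
    (hS : ∀ u ∈ exceptionalWeights 𝒢, p ∣ u)
    (hb : IsDeflationBasis p (exceptionalWeights 𝒢) ν b s) {m : ℕ} (hn : 1 ≤ n) (hm : 1 ≤ m) :
    h.toInflation (p := p) h0 b s ⁅v n, v m⁆ =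
      ⁅h.toInflation h0 b s (v n), h.toInflation h0 b s (v m)⁆ := by
  have hc := h.isStructureConstants hν
  obtain ⟨⟨i, j⟩, rfl⟩ := exists_inflationWeight_eq p hn
  obtain ⟨⟨k, l⟩, rfl⟩ := exists_inflationWeight_eq p hm
  have hij := inflationWeight_add (i, j)
  have hkl := inflationWeight_add (k, l)
  set n := inflationWeight p (i, j)
  set m := inflationWeight p (k, l)
  rw [hν hn hm, map_smul, h.toInflation_apply h0 i.2 hij, h.toInflation_apply h0 k.2 hkl,
    derExt_lie_mk_zero, LieAlgebra.ExtendScalars.bracket_tmul, hb.lie]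
  rcases lt_or_ge (i + k : ℕ) p with hlt | hge
  · rw [h.toInflation_apply h0 (j := j + l + 1) hlt (by linear_combination hij + hkl),
      hc.apply_eq_choose_mul hS hn hm hlt ⟨_, hij⟩ ⟨_, hkl⟩, hij, hkl, dividedPower_mul_of_lt hlt,
      TensorProduct.tmul_smul, TensorProduct.smul_tmul', smul_smul, mul_comm,
      LieAlgebra.SemiDirectSum.smul_eq_mk, smul_zero]
    rfl
  · rw [hc.apply_eq_zero_of_le_add hS hn hm i.2 k.2 ⟨_, hij⟩ ⟨_, hkl⟩ hge, zero_smul,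
      dividedPower_mul_of_le hge, TensorProduct.zero_tmul]
    rfl

theorem toInflation_lie_x (h : IsAdapted 𝒢 x v) (h0 : 𝒢 0 = ⊥) (hp2 : p ≠ 2)
    (hS : ∀ u ∈ exceptionalWeights 𝒢, p ∣ u)
    (hb : IsDeflationBasis p (exceptionalWeights 𝒢) ν b s) (hn : 1 ≤ n) :
    h.toInflation (p := p) h0 b s ⁅v n, x⁆ =
      ⁅h.toInflation h0 b s (v n), h.toInflation h0 b s x⁆ := by
  obtain ⟨⟨⟨i, hi⟩, j⟩, rfl⟩ := exists_inflationWeight_eq p hn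
  have hij := inflationWeight_add (⟨i, hi⟩, j)
  set n := inflationWeight p (⟨i, hi⟩, j)
  rw [h.lie_x hn, map_smul, h.toInflation_apply h0 hi hij, h.toInflation_x, derExt_lie_mk_right,
    one_smul]
  rcases i with _ | i
  · rw [h.toInflation_apply h0 (i := p - 1) (j := j + 1) (by omega)
        (by rw [mul_add p (j + 1), ← hij]; dsimp only; omega),
      inflationDer_dividedPower_zero_tmul hp2, neg_neg, hb.idealDer_apply,
      TensorProduct.tmul_smul, LieAlgebra.SemiDirectSum.smul_eq_mk, smul_zero, ← hij]
    rfl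
  · have hnS : n ∈ (exceptionalWeights 𝒢)ᶜ := fun hmem =>
      Nat.not_dvd_of_pos_of_lt i.succ_pos hi ((Nat.dvd_add_right (hS n hmem)).1 ⟨_, hij⟩)
    rw [h.toInflation_apply h0 (i := i) (j := j) (by omega) (by rw [← hij]; dsimp only; omega),
      inflationDer_dividedPower_succ_tmul hi, neg_neg, Set.indicator_of_mem hnS, Pi.one_apply,
      one_smul]

/-- The isomorphism `toInflation`, when the second two-step centralizer occurs only in weights
divisible by `p`. -/
def lieEquivInflation (h : IsAdapted 𝒢 x v) (h0 : 𝒢 0 = ⊥) (hp2 : p ≠ 2)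
    (hν : ∀ {i j}, 1 ≤ i → 1 ≤ j → ⁅v i, v j⁆ = ν i j • v (i + j))
    (hS : ∀ u ∈ exceptionalWeights 𝒢, p ∣ u)
    (hb : IsDeflationBasis p (exceptionalWeights 𝒢) ν b s) : L ≃ₗ⁅F⁆ Inflation p I s :=
  { h.toInflation h0 b s with
    map_lie' := by
      refine map_lie_of_span_eq_top (h.span_eq_top h0 (f := Nat.succ) (Set.ext fun n => ?_))
        (h.toInflation h0 b s).toLinearMap ?_ _ _
      · exact ⟨fun ⟨k, hk⟩ => hk ▸ k.succ_pos, fun hn => ⟨n - 1, Nat.succ_pred_eq_of_pos hn⟩⟩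
      rintro _ ⟨_ | k, rfl⟩ _ ⟨_ | l, rfl⟩
      · simp
      · change h.toInflation h0 b s ⁅x, v l.succ⁆ =
          ⁅h.toInflation h0 b s x, h.toInflation h0 b s (v l.succ)⁆
        rw [← lie_skew, map_neg, h.toInflation_lie_x h0 hp2 hS hb l.succ_pos, lie_skew]
      · exact h.toInflation_lie_x h0 hp2 hS hb k.succ_pos
      · exact h.toInflation_lie h0 hν hS hb k.succ_pos l.succ_pos }

end IsAdapted

end InflationEquiv

section InflationGrading

variable {F N : Type*} [Field F] [LieRing N] [LieAlgebra F N]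
variable {p : ℕ} [Fact p.Prime] [CharP F p] {ℋ : ℕ → Submodule F N}
variable {I : LieIdeal F N} {b : Module.Basis ℕ F I} {s : N} {i j n : ℕ}

omit [Fact p.Prime] [CharP F p] in
theorem iSup_map_mk_eq_span
    (hℋ : ∀ j, (ℋ (j + 1)).comap I.toSubmodule.subtype = Submodule.span F {b j})
    (hn : 1 ≤ n) (hi : i < p) (hij : n + i = p * (j + 1)) :
    (⨆ (j : ℕ) (i : ℕ) (_ : i < p ∧ n + i = p * j),
      ((ℋ j).comap I.toSubmodule.subtype).map (TensorProduct.mk F (Trunc F p) I (eps F p ^ i))) =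
      Submodule.span F {(eps F p ^ i) ⊗ₜ[F] b j} := by
  have map_eq_span (i j : ℕ) : ((ℋ (j + 1)).comap I.toSubmodule.subtype).map
      (TensorProduct.mk F (Trunc F p) I (eps F p ^ i)) =
        Submodule.span F {(eps F p ^ i) ⊗ₜ[F] b j} := by
    rw [hℋ, Submodule.map_span, Set.image_singleton, TensorProduct.mk_apply]
  refine le_antisymm (iSup_le fun l => iSup_le fun k => iSup_le fun ⟨hk, hkl⟩ => ?_) ?_
  · obtain _ | l := l
    · omega
    have same_weight : inflationWeight p (⟨k, hk⟩, l) = inflationWeight p (⟨i, hi⟩, j) := by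
      simp only [inflationWeight, ← hkl, ← hij, Nat.add_sub_cancel]
    cases inflationWeight_injective same_weight
    exact (map_eq_span i j).le
  · exact (map_eq_span i j).ge.trans (le_iSup_of_le (j + 1) (le_iSup_of_le i
      (le_iSup_of_le ⟨hi, hij⟩ le_rfl)))

theorem mem_inflationGrading_iff
    (hℋ : ∀ j, (ℋ (j + 1)).comap I.toSubmodule.subtype = Submodule.span F {b j})
    (hn : 1 ≤ n) (hi : i < p) (hij : n + i = p * (j + 1)) {z : Inflation p I s} :
    z ∈ inflationGrading p ℋ I s n ↔
      (∃ c : F, c • (dividedPower F p i ⊗ₜ[F] b j) = z.left) ∧ (n ≠ 1 → z.right = 0) := by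
  have span_eq : Submodule.span F {(eps F p ^ i) ⊗ₜ[F] b j} =
      Submodule.span F {dividedPower F p i ⊗ₜ[F] b j} := by
    rw [dividedPower, ← TensorProduct.smul_tmul',
      Submodule.span_singleton_smul_eq (isUnit_dividedPower_coeff hi)]
  rw [← Submodule.mem_span_singleton, ← span_eq, ← iSup_map_mk_eq_span hℋ hn hi hij]
  rfl

omit [Fact p.Prime] in
theorem inflationGrading_zero (h0 : ℋ 0 = ⊥) : inflationGrading p ℋ I s 0 = ⊥ := by
  have iSup_le_bot : (⨆ (j : ℕ) (i : ℕ) (_ : i < p ∧ 0 + i = p * j),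
      ((ℋ j).comap I.toSubmodule.subtype).map
        (TensorProduct.mk F (Trunc F p) I (eps F p ^ i))) ≤ ⊥ := by
    refine iSup_le fun j => iSup_le fun i => iSup_le fun ⟨hi, hij⟩ => ?_
    obtain _ | j := j
    · rw [h0, Submodule.comap_bot, Submodule.ker_subtype, Submodule.map_bot]
    · rw [mul_add] at hij
      omega
  exact eq_bot_iff.2 fun z hz => (Submodule.mem_bot F).2
    (LieAlgebra.SemiDirectSum.ext (iSup_le_bot hz.1) (hz.2 zero_ne_one))

theorem inflationGrading_one
    (hℋ : ∀ j, (ℋ (j + 1)).comap I.toSubmodule.subtype = Submodule.span F {b j})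
    (hi : i < p) (hij : 1 + i = p * (j + 1)) :
    inflationGrading p ℋ I s 1 =
      Submodule.span F {⟨0, 1⟩, ⟨dividedPower F p i ⊗ₜ b j, 0⟩} := by
  ext z
  rw [mem_inflationGrading_iff hℋ le_rfl hi hij, Submodule.mem_span_pair]
  constructor
  · rintro ⟨⟨c, hc⟩, -⟩
    exact ⟨z.right, c, LieAlgebra.SemiDirectSum.ext (by simp [hc]) (by simp)⟩
  · rintro ⟨a, c, rfl⟩
    exact ⟨⟨c, by simp⟩, fun hne => absurd rfl hne⟩

theorem inflationGrading_of_two_le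
    (hℋ : ∀ j, (ℋ (j + 1)).comap I.toSubmodule.subtype = Submodule.span F {b j})
    (hn : 2 ≤ n) (hi : i < p) (hij : n + i = p * (j + 1)) :
    inflationGrading p ℋ I s n = Submodule.span F {⟨dividedPower F p i ⊗ₜ b j, 0⟩} := by
  ext z
  rw [mem_inflationGrading_iff hℋ (by omega) hi hij, Submodule.mem_span_singleton]
  constructor
  · rintro ⟨⟨c, hc⟩, hright⟩
    exact ⟨c, LieAlgebra.SemiDirectSum.ext (by simp [hc]) (by simp [hright (by omega)])⟩
  · rintro ⟨c, rfl⟩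
    exact ⟨⟨c, rfl⟩, fun _ => by simp⟩

variable {L : Type*} [LieRing L] [LieAlgebra F L] {𝒢 : ℕ → Submodule F L} [GradedLieAlgebra 𝒢]
variable {x : L} {v : ℕ → L}

theorem IsAdapted.map_toInflation (h : IsAdapted 𝒢 x v) (h0 : 𝒢 0 = ⊥) (hℋ0 : ℋ 0 = ⊥)
    (hℋ : ∀ j, (ℋ (j + 1)).comap I.toSubmodule.subtype = Submodule.span F {b j}) (n : ℕ) :
    (𝒢 n).map (h.toInflation h0 b s).toLinearMap = inflationGrading p ℋ I s n := by
  obtain _ | n := n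
  · rw [h0, Submodule.map_bot, inflationGrading_zero hℋ0]
  obtain ⟨⟨⟨i, hi⟩, j⟩, hweight⟩ := exists_inflationWeight_eq p n.succ_pos
  have hij : n + 1 + i = p * (j + 1) := by
    rw [← Nat.succ_eq_add_one n, ← hweight, inflationWeight_add]
  have apply_v := h.toInflation_apply (b := b) (s := s) h0 hi hij
  obtain _ | n := n
  · rw [zero_add] at apply_v ⊢
    rw [h.component_one, inflationGrading_one hℋ hi (by simpa using hij), Submodule.map_span,
      Set.image_pair, LinearEquiv.coe_coe, h.toInflation_x, apply_v]
  · rw [h.component (by omega), inflationGrading_of_two_le hℋ (by omega) hi hij,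
      Submodule.map_span, Set.image_singleton, LinearEquiv.coe_coe, apply_v]

end InflationGrading

/-! ### The ideal of the deflation -/

section Deflation

variable {F L : Type*} [Field F] [LieRing L] [LieAlgebra F L]
variable {𝒢 : ℕ → Submodule F L} [GradedLieAlgebra 𝒢] {x : L} {v : ℕ → L}
variable {p : ℕ} [Fact p.Prime] [CharP F p] {j k n : ℕ}

namespace IsAdapted

omit [GradedLieAlgebra 𝒢] in
theorem ad_pow_apply (h : IsAdapted 𝒢 x v) (hn : 1 ≤ n)
    (hne : ∀ l < k, n + l ∉ exceptionalWeights 𝒢) :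
    (LieAlgebra.ad F L x ^ k) (v n) = (-1 : F) ^ k • v (n + k) := by
  induction k with
  | zero => simp
  | succ k ih =>
    have ad_x : ⁅x, v (n + k)⁆ = -v (n + (k + 1)) := by
      rw [← lie_skew, h.lie_x (by omega), Set.indicator_of_mem (hne k k.lt_succ_self),
        Pi.one_apply, one_smul, add_assoc]
    rw [pow_succ', Module.End.mul_apply, ih fun l hl => hne l (by omega), map_smul,
      LieAlgebra.ad_apply, ad_x, pow_succ, mul_smul, neg_one_smul]

omit [GradedLieAlgebra 𝒢] in
theorem adPow_apply (h : IsAdapted 𝒢 x v) (hp2 : p ≠ 2) (hS : ∀ u ∈ exceptionalWeights 𝒢, p ∣ u)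
    (hn : 1 ≤ n) (hpn : p ∣ n) :
    adPow F p x (v n) = -((exceptionalWeights 𝒢)ᶜ.indicator (1 : ℕ → F) n • v (n + p)) := by
  have hp : p.Prime := Fact.out
  change (LieAlgebra.ad F L x ^ p) (v n) = _
  by_cases hnS : n ∈ exceptionalWeights 𝒢
  · have hnS' := Set.notMem_compl_iff.2 hnS
    have ad_x : ⁅x, v n⁆ = 0 := by
      rw [← lie_skew, h.lie_x hn, Set.indicator_of_notMem hnS', zero_smul,
        neg_zero]
    rw [Set.indicator_of_notMem hnS', zero_smul, neg_zero,
      ← Nat.succ_pred_eq_of_pos hp.pos, pow_succ, Module.End.mul_apply, LieAlgebra.ad_apply, ad_x,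
      map_zero]
  · have ordinary : ∀ l < p, n + l ∉ exceptionalWeights 𝒢 := by
      intro l hl hmem
      obtain rfl := Nat.eq_zero_of_dvd_of_lt ((Nat.dvd_add_right hpn).1 (hS _ hmem)) hl
      exact hnS hmem
    rw [h.ad_pow_apply hn ordinary, (hp.odd_of_ne_two hp2).neg_one_pow, neg_one_smul,
      Set.indicator_of_mem (show n ∈ _ from hnS), Pi.one_apply, one_smul]

/-- The element `v (p (j + 1))` of the deflation, which has weight `j + 1` there. -/
def deflationVec (h : IsAdapted 𝒢 x v) (p : ℕ) [Fact p.Prime] [CharP F p] (j : ℕ) :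
    Deflation p 𝒢 x h.x_mem :=
  ⟨⟨v (p * (j + 1)), Submodule.mem_iSup_of_mem (j + 1)
    (h.mem (Nat.mul_pos (Fact.out : p.Prime).pos j.succ_pos))⟩, 0⟩

theorem linearIndependent_deflationVec (h : IsAdapted 𝒢 x v) :
    LinearIndependent F (h.deflationVec p) := by
  have hp : p.Prime := Fact.out
  refine LinearIndependent.of_comp ((multiples p 𝒢).toSubmodule.subtype ∘ₗ
    LieAlgebra.SemiDirectSum.projl (derHom (deflationDer p 𝒢 x h.x_mem))) ?_
  exact h.linearIndependent_comp (f := fun j => p * (j + 1))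
    (fun a b hab => by simpa [hp.ne_zero] using hab) fun k => Nat.mul_pos hp.pos k.succ_pos

theorem deflationVec_mem (h : IsAdapted 𝒢 x v) (j : ℕ) :
    h.deflationVec p j ∈ deflationGrading p 𝒢 x h.x_mem (j + 1) :=
  ⟨h.mem (Nat.mul_pos (Fact.out : p.Prime).pos j.succ_pos), fun _ => rfl⟩

theorem mem_span_deflationVec (h : IsAdapted 𝒢 x v) {z : Deflation p 𝒢 x h.x_mem}
    (hz : z ∈ deflationGrading p 𝒢 x h.x_mem (j + 1)) (hright : z.right = 0) :
    z ∈ Submodule.span F {h.deflationVec p j} := by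
  have left_mem : (z.left : L) ∈ 𝒢 (p * (j + 1)) := hz.1
  have two_le : 2 ≤ p * (j + 1) :=
    (Fact.out : p.Prime).two_le.trans (Nat.le_mul_of_pos_right p j.succ_pos)
  rw [h.component two_le] at left_mem
  obtain ⟨c, hc⟩ := Submodule.mem_span_singleton.1 left_mem
  refine Submodule.mem_span_singleton.2 ⟨c, LieAlgebra.SemiDirectSum.ext (Subtype.ext hc) ?_⟩
  exact hright ▸ smul_zero c

/-- The ideal of the deflation which is spanned by `v p, v (2 p), …`. -/
abbrev deflationIdeal (h : IsAdapted 𝒢 x v) (h0 : 𝒢 0 = ⊥) (p : ℕ) [Fact p.Prime] [CharP F p] :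
    LieIdeal F (Deflation p 𝒢 x h.x_mem) :=
  idealOf (deflationGrading p 𝒢 x h.x_mem) (deflationGrading_zero p 𝒢 h0 x h.x_mem)
    (iSup_deflationGrading p 𝒢 x h.x_mem) (Submodule.span F {h.deflationVec p 0})

theorem span_range_deflationVec (h : IsAdapted 𝒢 x v) (h0 : 𝒢 0 = ⊥) :
    Submodule.span F (Set.range (h.deflationVec p)) = (h.deflationIdeal h0 p).toSubmodule := by
  change _ = Submodule.span F {h.deflationVec p 0} ⊔ ⨆ i, deflationGrading p 𝒢 x h.x_mem (i + 2)
  have singleton_subset (j : ℕ) : {h.deflationVec p j} ⊆ Set.range (h.deflationVec p) :=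
    Set.singleton_subset_iff.2 ⟨j, rfl⟩
  apply le_antisymm
  · rw [Submodule.span_le]
    rintro _ ⟨_ | j, rfl⟩
    · exact Submodule.mem_sup_left (Submodule.mem_span_singleton_self _)
    · exact Submodule.mem_sup_right (Submodule.mem_iSup_of_mem j (h.deflationVec_mem (j + 1)))
  · refine sup_le (Submodule.span_mono (singleton_subset 0)) (iSup_le fun i z hz => ?_)
    exact Submodule.span_mono (singleton_subset (i + 1))
      (h.mem_span_deflationVec hz (hz.2 (by omega)))

/-- The basis `v p, v (2 p), …` of the ideal which these elements span in the deflation. -/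
def deflationBasis (h : IsAdapted 𝒢 x v) (h0 : 𝒢 0 = ⊥) (p : ℕ) [Fact p.Prime] [CharP F p] :
    Module.Basis ℕ F (h.deflationIdeal h0 p) :=
  (Module.Basis.span h.linearIndependent_deflationVec).map
    (LinearEquiv.ofEq _ _ (h.span_range_deflationVec h0))

theorem coe_deflationBasis (h : IsAdapted 𝒢 x v) (h0 : 𝒢 0 = ⊥) (j : ℕ) :
    (h.deflationBasis h0 p j : Deflation p 𝒢 x h.x_mem) = h.deflationVec p j := by
  rw [deflationBasis, Module.Basis.map_apply, Module.Basis.span_apply]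
  rfl

theorem right_eq_zero_of_mem_deflationIdeal (h : IsAdapted 𝒢 x v) (h0 : 𝒢 0 = ⊥)
    {z : Deflation p 𝒢 x h.x_mem} (hz : z ∈ h.deflationIdeal h0 p) : z.right = 0 := by
  have le_ker : (h.deflationIdeal h0 p).toSubmodule ≤ LinearMap.ker
      (LieAlgebra.SemiDirectSum.projr (derHom (deflationDer p 𝒢 x h.x_mem))).toLinearMap := by
    rw [← h.span_range_deflationVec h0, Submodule.span_le]
    rintro _ ⟨j, rfl⟩
    rfl
  exact le_ker hz

theorem comap_deflationGrading (h : IsAdapted 𝒢 x v) (h0 : 𝒢 0 = ⊥) (j : ℕ) :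
    (deflationGrading p 𝒢 x h.x_mem (j + 1)).comap (h.deflationIdeal h0 p).toSubmodule.subtype =
      Submodule.span F {h.deflationBasis h0 p j} := by
  refine le_antisymm (fun z hz => ?_) ?_
  · obtain ⟨c, hc⟩ := Submodule.mem_span_singleton.1
      (h.mem_span_deflationVec hz (h.right_eq_zero_of_mem_deflationIdeal h0 z.2))
    refine Submodule.mem_span_singleton.2 ⟨c, Subtype.ext ?_⟩
    rw [← h.coe_deflationBasis h0] at hc
    exact hc
  · rw [Submodule.span_singleton_le_iff_mem, Submodule.mem_comap, Submodule.subtype_apply,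
      h.coe_deflationBasis]
    exact h.deflationVec_mem j

variable {ν : ℕ → ℕ → F}

theorem lie_deflationVec (h : IsAdapted 𝒢 x v)
    (hν : ∀ {i j}, 1 ≤ i → 1 ≤ j → ⁅v i, v j⁆ = ν i j • v (i + j)) (i j : ℕ) :
    ⁅h.deflationVec p i, h.deflationVec p j⁆ =
      ν (p * (i + 1)) (p * (j + 1)) • h.deflationVec p (i + j + 1) := by
  have hp : 0 < p := (Fact.out : p.Prime).pos
  rw [deflationVec, deflationVec, deflationVec, derExt_lie_mk_zero,
    LieAlgebra.SemiDirectSum.smul_eq_mk, smul_zero]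
  refine LieAlgebra.SemiDirectSum.ext (Subtype.ext ?_) rfl
  change ⁅v (p * (i + 1)), v (p * (j + 1))⁆ = _ • v (p * (i + j + 1 + 1))
  rw [hν (Nat.mul_pos hp i.succ_pos) (Nat.mul_pos hp j.succ_pos),
    show p * (i + 1) + p * (j + 1) = p * (i + j + 1 + 1) by ring]

theorem lie_neg_one_deflationVec (h : IsAdapted 𝒢 x v) (hp2 : p ≠ 2)
    (hS : ∀ u ∈ exceptionalWeights 𝒢, p ∣ u) (j : ℕ) :
    ⁅(⟨0, -1⟩ : Deflation p 𝒢 x h.x_mem), h.deflationVec p j⁆ =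
      (exceptionalWeights 𝒢)ᶜ.indicator (1 : ℕ → F) (p * (j + 1)) • h.deflationVec p (j + 1) := by
  rw [deflationVec, deflationVec, ← lie_skew, derExt_lie_mk_right,
    LieAlgebra.SemiDirectSum.smul_eq_mk, smul_zero, neg_smul, one_smul]
  refine LieAlgebra.SemiDirectSum.ext (Subtype.ext ?_) ?_
  · change - - - adPow F p x (v (p * (j + 1))) = _ • v (p * (j + 1 + 1))
    rw [neg_neg, h.adPow_apply hp2 hS (Nat.mul_pos (Fact.out : p.Prime).pos j.succ_pos)
      (dvd_mul_right p _), neg_neg, mul_add_one p (j + 1)]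
  · exact neg_zero (G := F)

theorem isDeflationBasis (h : IsAdapted 𝒢 x v) (h0 : 𝒢 0 = ⊥) (hp2 : p ≠ 2)
    (hν : ∀ {i j}, 1 ≤ i → 1 ≤ j → ⁅v i, v j⁆ = ν i j • v (i + j))
    (hS : ∀ u ∈ exceptionalWeights 𝒢, p ∣ u) :
    IsDeflationBasis p (exceptionalWeights 𝒢) ν (h.deflationBasis h0 p) ⟨0, -1⟩ where
  lie i j := Subtype.ext <| by
    rw [LieSubmodule.coe_smul, LieIdeal.coe_bracket_of_module, LieSubmodule.coe_bracket,
      coe_deflationBasis, coe_deflationBasis, coe_deflationBasis, h.lie_deflationVec hν]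
  idealDer_apply j := Subtype.ext <| by
    rw [LieSubmodule.coe_smul, coe_deflationBasis]
    change ⁅_, (h.deflationBasis h0 p j).1⁆ = _
    rw [coe_deflationBasis, h.lie_neg_one_deflationVec hp2 hS]

omit [GradedLieAlgebra 𝒢] in
theorem x_notMem_twoStep_two (h : IsAdapted 𝒢 x v) : x ∉ twoStep 𝒢 2 := fun hx2 => by
  have ordinary : 2 ∈ (exceptionalWeights 𝒢)ᶜ := fun h2 =>
    (two_lt_of_mem_exceptionalWeights h2).ne rfl
  refine h.ne_zero (n := 3) (by omega) ?_
  have lie_x := h.lie_x (n := 2) (by omega)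
  rwa [Set.indicator_of_mem ordinary, Pi.one_apply, one_smul, ← lie_skew,
    hx2.2 _ (h.mem one_le_two), neg_zero, eq_comm] at lie_x

theorem isInflated (h : IsAdapted 𝒢 x v) (hL : IsMaximalClass 𝒢) (hp2 : p ≠ 2)
    (hν : ∀ {i j}, 1 ≤ i → 1 ≤ j → ⁅v i, v j⁆ = ν i j • v (i + j))
    (hS : ∀ u ∈ exceptionalWeights 𝒢, p ∣ u) : IsInflated p 𝒢 hL := by
  have h0 := hL.zero_eq_bot
  have hb := h.isDeflationBasis h0 hp2 hν hS
  have s_notMem : (⟨0, -1⟩ : Deflation p 𝒢 x h.x_mem) ∉ Submodule.span F {h.deflationVec p 0} :=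
    fun hs => neg_ne_zero.2 (one_ne_zero (α := F))
      (h.right_eq_zero_of_mem_deflationIdeal h0 (Submodule.mem_sup_left hs))
  refine ⟨x, h.x_mem, h.x_notMem_twoStep_two, Submodule.span F {h.deflationVec p 0},
    (Submodule.span_singleton_le_iff_mem _ _).2 (h.deflationVec_mem 0),
    finrank_span_singleton (h.linearIndependent_deflationVec.ne_zero 0),
    ⟨0, -1⟩, ⟨zero_mem _, fun h1 => absurd rfl h1⟩, s_notMem,
    h.lieEquivInflation h0 hp2 hν hS hb, fun n w => ?_⟩
  have map_eq := h.map_toInflation (s := ⟨0, -1⟩) h0 (deflationGrading_zero p 𝒢 h0 x h.x_mem)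
    (h.comap_deflationGrading h0) n
  exact (LinearEquiv.injective _).mem_set_image.symm.trans (SetLike.ext_iff.1 map_eq _)

end IsAdapted

end Deflation

end MaximalClass

end

theorem mainTheorem6 {F L : Type*} [Field F] (p : ℕ) [Fact p.Prime] [CharP F p] (hp : p ≠ 2)
    [LieRing L] [LieAlgebra F L] (𝒢 : ℕ → Submodule F L) [GradedLieAlgebra 𝒢]
    (hL : MaximalClass.IsMaximalClass 𝒢) (hinf : ¬ Module.Finite F L)
    (htwo : (MaximalClass.twoStepSet 𝒢).ncard = 2)
    (hlong : ∃ i m, MaximalClass.IsSecondNonShort 𝒢 i m ∧ MaximalClass.IsLong 𝒢 m) :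
    (∀ i m, MaximalClass.IsConstituent 𝒢 i m →
      MaximalClass.IsShort 𝒢 m ∨ MaximalClass.IsLong 𝒢 m) ∧
    MaximalClass.IsInflated p 𝒢 hL := by
  obtain ⟨x, v, h⟩ := hL.exists_isAdapted hinf htwo
  obtain ⟨ν, hν⟩ := h.exists_forall_lie_eq
  have structureConstants := h.isStructureConstants hν
  obtain ⟨i, m, hsecond, hm⟩ := hlong
  have short_or_long : ∀ j l, MaximalClass.IsConstituent 𝒢 j l →
      MaximalClass.IsShort 𝒢 l ∨ MaximalClass.IsLong 𝒢 l :=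
    fun j l => hsecond.isShort_or_isLong hm structureConstants hp
  have dvd_weights : ∀ u ∈ MaximalClass.exceptionalWeights 𝒢, p ∣ u :=
    hsecond.dvd_of_mem_exceptionalWeights hm structureConstants hp
  exact ⟨short_or_long, h.isInflated hL hp hν dvd_weights⟩
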